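/- Let $n\ge 1$; all representations are complex. Let $X=\begin{pmatrix}0&1\\1&0\end{pmatrix}$, $Z=\begin{pmatrix}1&0\\0&-1\end{pmatrix}$ and $H=\frac1{\sqrt2}\begin{pmatrix}1&1\\1&-1\end{pmatrix}$; $A_j$ denotes the $2\times2$ matrix $A$ acting on the $j$-th tensor factor (qubit) of $(\mathbb C^2)^{\otimes n}$, and $CX_{1,2}$ is the controlled-$X$ gate with control qubit $1$ and target qubit $2$. Let $\mathcal P_n\le U(2^n)$ be the Pauli group of all $n$-fold tensor products of elements of $\langle X,Z,iI_2\rangle$, let $\mathrm{Cliff}(n)$ be its normalizer in $U(2^n)$, let $\mathcal C_n=\mathrm{Cliff}(n)/U(1)$, and let $[U]$ be the class of $U$ in $\mathcal C_n$. For $x=(p,q)\in\mathbb Z_2^{2n}$ put $W_x=\bigotimes_j Z^{p_j}X^{q_j}$ (up to a phase); the map $x\mapsto[W_x]$ identifies $\mathbb Z_2^{2n}$ with the projective Pauli group, the image of $\mathcal P_n$ in $\mathcal C_n$. Each $[U]\in\mathcal C_n$ acts on $\mathbb Z_2^{2n}$ by the matrix $\Gamma\in Sp(2n,2)$ with $[U][W_x][U]^{-1}=[W_{\Gamma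 x}]$ for all $x$, and projective Paulis act trivially. Let $$IN_n=\langle [M],\,[H_1],\,[X_1],\,[I\otimes A] : A\in \mathrm{Cliff}(n-1)\rangle\le\mathcal C_n,\qquad M=CX_{1,2}(Z_1H_1X_2)CX_{1,2},$$ where the generator $[M]$ is omitted for $n=1$. Then $IN_n/\mathbb Z_2^{2n}$ acts on $\mathbb Z_2^{2n}$ through $Sp(2n,2)$, which gives a homomorphism $$\iota:(IN_n/\mathbb Z_2^{2n})\ltimes\mathbb Z_2^{2n}\to G:=Sp(2n,2)\ltimes\mathbb Z_2^{2n}.$$ Let $\sigma_1$ be the character of $\mathbb Z_2^{2n}$ with $\sigma_1(p,q)=(-1)^{p_1+q_1}$, that is, the value is $-1$ at $[X_1]$ and $[Z_1]$, and $1$ at $[X_j]$ and $[Z_j]$ for $j\ge2$. Let $\sigma_1''(x,\Gamma)=\sigma_1(x)$ be its extension to $(IN_n/\mathbb Z_2^{2n})\ltimes\mathbb Z_2^{2n}$. **Lemma.** The map $\iota$ is injective, and its image is the inertia subgroup $I_G(\sigma_1)=\{g\in G:{}^g\sigma_1\sim\sigma_1\}$, where ${}^g\sigma_1(x)=\sigma_1(g^{-1}xg)$.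 Up to equivalence, the irreducible representations of the affine symplectic group are $$\widehat{G}=\left\{\mathrm{Ind}^{G}_{(IN_n/\mathbb Z_2^{2n})\ltimes\mathbb Z_2^{2n}}(\sigma_1''\otimes\widetilde\psi):\psi\in\widehat{IN_n/\mathbb Z_2^{2n}}\right\}\cup\left\{\widetilde\psi:\psi\in\widehat{Sp(2n,2)}\right\},$$ where $\widetilde\psi$ is the inflation of $\psi$ to $(IN_n/\mathbb Z_2^{2n})\ltimes\mathbb Z_2^{2n}$ in the first set and to $G$ in the second. That is, a representation of $G$ is irreducible if and only if it is equivalent to a member of one of the two sets. Moreover, the listed representations are pairwise inequivalent: inequivalent $\psi$ give inequivalent members of the same set, and no member of the first set is equivalent to a member of the second. -/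

import Mathlib

open Matrix

universe u

namespace CliffordLift

/-! ### Operators on `n` qubits

`ℂ^(2^n)` has its computational basis indexed by bit strings `Fin n → Fin 2`. -/

/-- Square matrices of size `2^n`. -/
abbrev Op (n : ℕ) : Type := Matrix (Fin n → Fin 2) (Fin n → Fin 2) ℂ

/-- The unitary group `U(2^n)`. -/
abbrev UnitaryOp (n : ℕ) : Type := Matrix.unitaryGroup (Fin n → Fin 2) ℂ

/-- The `n`-fold tensor (Kronecker) product of 2-by-2 matrices. -/
def tensorMat (n : ℕ) : (Fin n → Matrix (Fin 2) (Fin 2) ℂ) →* Op n where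
  toFun A := Matrix.of fun x y => ∏ i, A i (x i) (y i)
  map_one' := by
    ext x y
    simp only [Matrix.of_apply, Pi.one_apply, Matrix.one_apply]
    by_cases h : x = y
    · simp [h]
    · obtain ⟨i, hi⟩ := Function.ne_iff.mp h
      rw [if_neg h]
      exact Finset.prod_eq_zero (Finset.mem_univ i) (if_neg hi)
  map_mul' A B := by
    ext x y
    simp only [Matrix.of_apply, Pi.mul_apply, Matrix.mul_apply, ← Finset.prod_mul_distrib]
    rw [Finset.prod_univ_sum]
    simp

theorem tensorMat_apply (n : ℕ) (A : Fin n → Matrix (Fin 2) (Fin 2) ℂ) (x y : Fin n → Fin 2) :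
    tensorMat n A x y = ∏ i, A i (x i) (y i) := rfl

theorem tensorMat_smul (n : ℕ) (c : Fin n → ℂ) (A : Fin n → Matrix (Fin 2) (Fin 2) ℂ) :
    tensorMat n (fun i => c i • A i) = (∏ i, c i) • tensorMat n A := by
  ext x y
  simp [tensorMat_apply, Finset.prod_mul_distrib]

theorem star_tensorMat (n : ℕ) (A : Fin n → Matrix (Fin 2) (Fin 2) ℂ) :
    star (tensorMat n A) = tensorMat n (star A) := by
  ext x y
  simp [tensorMat_apply, Matrix.star_apply]

/-- The `n`-fold tensor product of 2-by-2 unitary matrices. -/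
def tensorU (n : ℕ) : (Fin n → Matrix.unitaryGroup (Fin 2) ℂ) →* UnitaryOp n where
  toFun A := ⟨tensorMat n fun i => (A i : Matrix (Fin 2) (Fin 2) ℂ), by
    rw [Matrix.mem_unitaryGroup_iff, star_tensorMat, ← map_mul]
    convert map_one (tensorMat n) using 2
    ext1 i
    exact Matrix.mem_unitaryGroup_iff.mp (A i).2⟩
  map_one' := Subtype.ext (map_one (tensorMat n))
  map_mul' A B := Subtype.ext (map_mul (tensorMat n) (fun i => (A i : Matrix (Fin 2) (Fin 2) ℂ))
    (fun i => (B i : Matrix (Fin 2) (Fin 2) ℂ)))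

theorem coe_tensorU (n : ℕ) (A : Fin n → Matrix.unitaryGroup (Fin 2) ℂ) :
    (tensorU n A : Op n) = tensorMat n fun i => (A i : Matrix (Fin 2) (Fin 2) ℂ) := rfl

/-! ### The Pauli and Clifford groups -/

/-- The Pauli matrix `X`. -/
def matX : Matrix (Fin 2) (Fin 2) ℂ := !![0, 1; 1, 0]

/-- The Pauli matrix `Z`. -/
def matZ : Matrix (Fin 2) (Fin 2) ℂ := !![1, 0; 0, -1]

/-- The Hadamard matrix `H`. -/
noncomputable def matH : Matrix (Fin 2) (Fin 2) ℂ :=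
  (1 / (Real.sqrt 2 : ℂ)) • !![1, 1; 1, -1]

/-- `X` as a unitary matrix. -/
def pauliX : Matrix.unitaryGroup (Fin 2) ℂ :=
  ⟨matX, by
    rw [Matrix.mem_unitaryGroup_iff]
    ext i j
    fin_cases i <;> fin_cases j <;> simp [matX, Matrix.mul_apply, Fin.sum_univ_two]⟩

/-- `Z` as a unitary matrix. -/
def pauliZ : Matrix.unitaryGroup (Fin 2) ℂ :=
  ⟨matZ, by
    rw [Matrix.mem_unitaryGroup_iff]
    ext i j
    fin_cases i <;> fin_cases j <;> simp [matZ, Matrix.mul_apply, Fin.sum_univ_two]⟩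

/-- The scalar `i I₂` as a unitary matrix. -/
def scalarI : Matrix.unitaryGroup (Fin 2) ℂ :=
  ⟨Complex.I • 1, by
    rw [Matrix.mem_unitaryGroup_iff]
    ext i j
    fin_cases i <;> fin_cases j <;> simp [Matrix.mul_apply, Fin.sum_univ_two]⟩

/-- The one-qubit Pauli group `⟨X, Z, i I₂⟩`. -/
def pauliOne : Subgroup (Matrix.unitaryGroup (Fin 2) ℂ) :=
  Subgroup.closure {pauliX, pauliZ, scalarI}

/-- The `n`-qubit Pauli group: all `n`-fold tensor products of elements of the one-qubit Pauli
group. -/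
def pauliGroup (n : ℕ) : Subgroup (UnitaryOp n) :=
  (Subgroup.pi Set.univ fun _ : Fin n => pauliOne).map (tensorU n)

/-- The `n`-qubit Clifford group: the normalizer of the Pauli group in `U(2^n)`. -/
def clifford (n : ℕ) : Subgroup (UnitaryOp n) :=
  Subgroup.normalizer (pauliGroup n : Set (UnitaryOp n))

/-- The group `U(1)` of phases: the unitary scalar matrices. -/
def phases (n : ℕ) : Subgroup (UnitaryOp n) where
  carrier := {U | ∃ z : ℂ, (U : Op n) = z • 1}
  one_mem' := ⟨1, by simp⟩
  mul_mem' := by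
    rintro U V ⟨z, hz⟩ ⟨w, hw⟩
    exact ⟨z * w, by rw [Matrix.UnitaryGroup.mul_val, hz, hw]; simp [smul_smul, mul_comm]⟩
  inv_mem' := by
    rintro U ⟨z, hz⟩
    exact ⟨star z, by rw [Matrix.UnitaryGroup.inv_val, hz]; simp⟩

instance phases_normal (n : ℕ) : (phases n).Normal where
  conj_mem := by
    rintro U ⟨z, hz⟩ V
    refine ⟨z, ?_⟩
    rw [Matrix.UnitaryGroup.mul_val, Matrix.UnitaryGroup.mul_val, hz]
    simp only [Matrix.mul_smul, Matrix.smul_mul, Matrix.mul_one]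
    rw [← Matrix.UnitaryGroup.mul_val, mul_inv_cancel, Matrix.UnitaryGroup.one_val]

instance phases_subgroupOf_normal (n : ℕ) : ((phases n).subgroupOf (clifford n)).Normal :=
  Subgroup.normal_subgroupOf

/-- The `n`-qubit projective Clifford group. -/
abbrev ProjClifford (n : ℕ) : Type := ↥(clifford n) ⧸ (phases n).subgroupOf (clifford n)

/-- The class `[U]` of a Clifford operator modulo phases. -/
def cls (n : ℕ) : ↥(clifford n) →* ProjClifford n :=
  QuotientGroup.mk' ((phases n).subgroupOf (clifford n))

/-- The `n`-qubit projective Pauli group, as a subgroup of the projective Clifford group. -/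
def projPauli (n : ℕ) : Subgroup (ProjClifford n) :=
  ((pauliGroup n).subgroupOf (clifford n)).map (cls n)

instance projPauli_normal (n : ℕ) : (projPauli n).Normal :=
  Subgroup.Normal.map (Subgroup.normal_in_normalizer (H := pauliGroup n)) (cls n)
    (QuotientGroup.mk'_surjective ((phases n).subgroupOf (clifford n)))

/-! ### The subgroup `IN_n`, on `n = m + 1` qubits -/

/-- The 2-by-2 matrix `A` acting on the `j`-th qubit. -/
def onQubit (n : ℕ) (j : Fin n) (A : Matrix (Fin 2) (Fin 2) ℂ) : Op n :=
  tensorMat n (Pi.mulSingle j A)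

/-- The controlled-`X` gate with control `c` and target `t`: it maps the basis vector `y` to the
basis vector with `t`-th bit `y t + y c` and the other bits unchanged. -/
def gateCX (n : ℕ) (c t : Fin n) : Op n :=
  Matrix.of fun x y => if x = Function.update y t (y t + y c) then 1 else 0

/-- The gate `CX₁ₜ (Z₁ H₁ Xₜ) CX₁ₜ`; the gate `M` is the case in which `t` is the second qubit. -/
noncomputable def gateM (m : ℕ) (t : Fin (m + 1)) : Op (m + 1) :=
  gateCX (m + 1) 0 t *
    (onQubit (m + 1) 0 matZ * onQubit (m + 1) 0 matH * onQubit (m + 1) t matX) *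
    gateCX (m + 1) 0 t

/-- The operator `I ⊗ A`, where `I` acts on the first qubit and `A` on the other `m` qubits. -/
def idTensor (m : ℕ) (A : Op m) : Op (m + 1) :=
  Matrix.of fun x y => (1 : Matrix (Fin 2) (Fin 2) ℂ) (x 0) (y 0) * A (Fin.tail x) (Fin.tail y)

/-- The matrices whose classes generate `IN_n`, `n = m + 1`: `M` (present if there is a second
qubit), `H₁`, `X₁` and `I ⊗ A` for `A` in the Clifford group on `n - 1` qubits. -/
def inertiaGenerators (m : ℕ) : Set (Op (m + 1)) :=
  {U | (∃ t : Fin (m + 1), t.val = 1 ∧ U = gateM m t) ∨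
    U = onQubit (m + 1) 0 matH ∨
    U = onQubit (m + 1) 0 matX ∨
    ∃ A ∈ clifford m, U = idTensor m A}

/-- The subgroup `IN_n` of the projective Clifford group, `n = m + 1`. -/
def IN (m : ℕ) : Subgroup (ProjClifford (m + 1)) :=
  Subgroup.closure {c | ∃ U : ↥(clifford (m + 1)),
    ((U : UnitaryOp (m + 1)) : Op (m + 1)) ∈ inertiaGenerators m ∧ c = cls (m + 1) U}

/-- The inertia quotient group `IN_n / ℤ₂^{2n}`, `n = m + 1`. -/
abbrev InertiaQuotient (m : ℕ) : Type := ↥(IN m) ⧸ (projPauli (m + 1)).subgroupOf (IN m)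

/-! ### The affine symplectic group -/

/-- The vectors `x = (p, q) ∈ ℤ₂^{2n}`, `p` on the left summand of the index and `q` on the
right. -/
abbrev Vec (n : ℕ) : Type := Fin n ⊕ Fin n → ZMod 2

/-- The symplectic group `Sp(2n, 2)`. -/
abbrev Sp (n : ℕ) : Type := ↥(Matrix.symplecticGroup (Fin n) (ZMod 2))

/-- The natural action of `Sp(2n, 2)` on the group `ℤ₂^{2n}` (written multiplicatively). -/
def spAction (n : ℕ) : Sp n →* MulAut (Multiplicative (Vec n)) where
  toFun Γ :=
    { toFun := fun x => Multiplicative.ofAdd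
        ((Γ : Matrix (Fin n ⊕ Fin n) (Fin n ⊕ Fin n) (ZMod 2)) *ᵥ x.toAdd)
      invFun := fun x => Multiplicative.ofAdd
        (((Γ⁻¹ : Sp n) : Matrix (Fin n ⊕ Fin n) (Fin n ⊕ Fin n) (ZMod 2)) *ᵥ x.toAdd)
      left_inv := fun x => by
        have h := congrArg Subtype.val (inv_mul_cancel Γ)
        rw [Submonoid.coe_mul, Submonoid.coe_one] at h
        simp [Matrix.mulVec_mulVec, h]
      right_inv := fun x => by
        have h := congrArg Subtype.val (mul_inv_cancel Γ)
        rw [Submonoid.coe_mul, Submonoid.coe_one] at h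
        simp [Matrix.mulVec_mulVec, h]
      map_mul' := fun x y => by simp [Matrix.mulVec_add] }
  map_one' := by ext x : 1; simp
  map_mul' Γ Δ := by ext x : 1; simp [Matrix.mulVec_mulVec]

/-- The affine symplectic group `Sp(2n, 2) ⋉ ℤ₂^{2n}`. -/
abbrev AffineSp (n : ℕ) : Type := Multiplicative (Vec n) ⋊[spAction n] Sp n

/-- The symplectic form `[(p, q), (p', q')] = p · q' - q · p'` modulo 2. -/
def form (n : ℕ) (x y : Vec n) : ZMod 2 :=
  ∑ i, (x (Sum.inl i) * y (Sum.inr i) - x (Sum.inr i) * y (Sum.inl i))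

/-- The sign `(-1)^a` for `a ∈ ℤ₂`. -/
def sgn (a : ZMod 2) : ℂ := (-1) ^ a.val

theorem zmod_two_cases (a : ZMod 2) : a = 0 ∨ a = 1 := by
  revert a; decide

theorem sgn_zero : sgn 0 = 1 := by simp [sgn]

theorem sgn_one : sgn 1 = -1 := by simp [sgn, ZMod.val_one]

theorem sgn_add (a b : ZMod 2) : sgn (a + b) = sgn a * sgn b := by
  have h2 : (1 + 1 : ZMod 2) = 0 := by decide
  rcases zmod_two_cases a with rfl | rfl <;> rcases zmod_two_cases b with rfl | rfl <;>
    simp [sgn_zero, sgn_one, h2]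

theorem sgn_ne_zero (a : ZMod 2) : sgn a ≠ 0 := by simp [sgn]

theorem sgn_injective : Function.Injective sgn := by
  intro a b h
  rcases zmod_two_cases a with rfl | rfl <;> rcases zmod_two_cases b with rfl | rfl <;>
    first | rfl | (norm_num [sgn_zero, sgn_one] at h)

theorem sgn_sum {ι : Type*} (s : Finset ι) (f : ι → ZMod 2) :
    sgn (∑ i ∈ s, f i) = ∏ i ∈ s, sgn (f i) := by
  classical
  induction s using Finset.induction_on with
  | empty => simp [sgn_zero]
  | insert a s ha ih => rw [Finset.sum_insert ha, Finset.prod_insert ha, sgn_add, ih]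

/-! ### Weyl operators and the action of the projective Clifford group on `ℤ₂^{2n}` -/

/-- The Weyl operator of `x = (p, q)`, up to a phase: the tensor product of the `Z^(p i) X^(q i)`. -/
def weylU (n : ℕ) (x : Vec n) : UnitaryOp n :=
  tensorU n fun i => pauliZ ^ (x (Sum.inl i)).val * pauliX ^ (x (Sum.inr i)).val

theorem weylU_mem_pauliGroup (n : ℕ) (x : Vec n) : weylU n x ∈ pauliGroup n := by
  refine Subgroup.mem_map_of_mem _ ?_
  rw [Subgroup.mem_pi]
  intro i _
  exact mul_mem (pow_mem (Subgroup.subset_closure (by simp)) _)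
    (pow_mem (Subgroup.subset_closure (by simp)) _)

/-- The class `[W_x]` in the projective Clifford group; `x ↦ [W_x]` identifies `ℤ₂^{2n}` with the
projective Pauli group. -/
def weyl (n : ℕ) (x : Vec n) : ProjClifford n :=
  cls n ⟨weylU n x, Subgroup.le_normalizer (weylU_mem_pauliGroup n x)⟩

theorem weyl_mem_projPauli (n : ℕ) (x : Vec n) : weyl n x ∈ projPauli n :=
  Subgroup.mem_map_of_mem _ (weylU_mem_pauliGroup n x)

/-- The one-qubit matrix `Z^p X^q`. -/
def weylOne (p q : ZMod 2) : Matrix (Fin 2) (Fin 2) ℂ := matZ ^ p.val * matX ^ q.val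

theorem coe_weylU (n : ℕ) (x : Vec n) :
    (weylU n x : Op n) = tensorMat n fun i => weylOne (x (Sum.inl i)) (x (Sum.inr i)) := rfl

theorem weylOne_mul (p q p' q' : ZMod 2) :
    weylOne p q * weylOne p' q' = sgn (q * p') • weylOne (p + p') (q + q') := by
  have h2 : (1 + 1 : ZMod 2) = 0 := by decide
  rcases zmod_two_cases p with rfl | rfl <;> rcases zmod_two_cases q with rfl | rfl <;>
  rcases zmod_two_cases p' with rfl | rfl <;> rcases zmod_two_cases q' with rfl | rfl <;>
    ext i j <;> fin_cases i <;> fin_cases j <;>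
    simp [weylOne, matX, matZ, h2, ZMod.val_one, sgn_zero, sgn_one, Matrix.mul_apply,
      Fin.sum_univ_two]

theorem weylU_mul (n : ℕ) (x y : Vec n) :
    (weylU n x : Op n) * weylU n y =
      sgn (∑ i, x (Sum.inr i) * y (Sum.inl i)) • (weylU n (x + y) : Op n) := by
  rw [coe_weylU, coe_weylU, coe_weylU, ← map_mul, sgn_sum, ← tensorMat_smul]
  congr 1
  ext1 i
  exact weylOne_mul _ _ _ _

theorem weylU_comm (n : ℕ) (x y : Vec n) :
    (weylU n x : Op n) * weylU n y = sgn (form n x y) • ((weylU n y : Op n) * weylU n x) := by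
  rw [weylU_mul, weylU_mul, smul_smul, ← sgn_add, add_comm y x]
  congr 2
  rw [form, ← Finset.sum_add_distrib]
  refine Finset.sum_congr rfl fun i _ => ?_
  generalize x (Sum.inl i) = a, x (Sum.inr i) = b, y (Sum.inl i) = c, y (Sum.inr i) = d
  revert a b c d
  decide

theorem cls_eq_iff (n : ℕ) (U V : ↥(clifford n)) :
    cls n U = cls n V ↔ ∃ z : ℂ, ((V : UnitaryOp n) : Op n) = z • ((U : UnitaryOp n) : Op n) := by
  rw [cls, QuotientGroup.mk'_apply, QuotientGroup.mk'_apply, QuotientGroup.eq,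
    Subgroup.mem_subgroupOf]
  constructor
  · rintro ⟨z, hz⟩
    refine ⟨z, ?_⟩
    have h : (V : UnitaryOp n) = U * ((U⁻¹ * V : ↥(clifford n)) : UnitaryOp n) := by simp
    rw [h, Matrix.UnitaryGroup.mul_val, hz]
    simp
  · rintro ⟨z, hz⟩
    refine ⟨z, ?_⟩
    rw [Subgroup.coe_mul, Matrix.UnitaryGroup.mul_val, hz, Matrix.mul_smul,
      ← Matrix.UnitaryGroup.mul_val, ← Subgroup.coe_mul, inv_mul_cancel]
    rfl

theorem weyl_add (n : ℕ) (x y : Vec n) : weyl n (x + y) = weyl n x * weyl n y := by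
  rw [weyl, weyl, weyl, ← map_mul, cls_eq_iff]
  exact ⟨_, weylU_mul n x y⟩

theorem weyl_zero (n : ℕ) : weyl n 0 = 1 := by
  have h := weyl_add n 0 0
  rw [add_zero] at h
  exact left_eq_mul.mp h

theorem unitary_ne_zero {n : ℕ} (U : UnitaryOp n) : (U : Op n) ≠ 0 := by
  intro h
  have h1 : (U : Op n) * star (U : Op n) = 1 := Matrix.mem_unitaryGroup_iff.mp U.2
  rw [h, zero_mul] at h1
  exact zero_ne_one h1

theorem form_eq_zero (n : ℕ) (x : Vec n) (h : ∀ y, form n x y = 0) : x = 0 := by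
  ext i
  rcases i with i | i
  · have := h (Pi.single (Sum.inr i) 1)
    simpa [form, Pi.single_apply] using this
  · have := h (Pi.single (Sum.inl i) 1)
    simpa [form, Pi.single_apply] using this

/-- Conjugation preserves commutation relations of Weyl operators. -/
theorem form_eq_of_conj (n : ℕ) (U : UnitaryOp n) (x y x' y' : Vec n) (z w : ℂ)
    (hx : (U : Op n) * weylU n x = z • ((weylU n x' : Op n) * U))
    (hy : (U : Op n) * weylU n y = w • ((weylU n y' : Op n) * U)) :
    form n x y = form n x' y' := by
  have h1 : ((U * (weylU n x * weylU n y) : UnitaryOp n) : Op n) =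
      (z * w) • (((weylU n x' : Op n) * weylU n y') * U) := by
    rw [Matrix.UnitaryGroup.mul_val, Matrix.UnitaryGroup.mul_val, ← mul_assoc, hx,
      Matrix.smul_mul, mul_assoc, hy, Matrix.mul_smul, smul_smul, mul_assoc]
  have h2 : ((U * (weylU n y * weylU n x) : UnitaryOp n) : Op n) =
      (z * w) • (((weylU n y' : Op n) * weylU n x') * U) := by
    rw [Matrix.UnitaryGroup.mul_val, Matrix.UnitaryGroup.mul_val, ← mul_assoc, hy,
      Matrix.smul_mul, mul_assoc, hx, Matrix.mul_smul, smul_smul, mul_assoc, mul_comm z w]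
  have h3 : ((U * (weylU n x * weylU n y) : UnitaryOp n) : Op n) =
      sgn (form n x y) • ((U * (weylU n y * weylU n x) : UnitaryOp n) : Op n) := by
    simp only [Matrix.UnitaryGroup.mul_val]
    rw [weylU_comm, Matrix.mul_smul]
  have h4 : ((U * (weylU n x * weylU n y) : UnitaryOp n) : Op n) =
      sgn (form n x' y') • ((U * (weylU n y * weylU n x) : UnitaryOp n) : Op n) := by
    rw [h1, h2, weylU_comm, Matrix.smul_mul, smul_comm]
  exact sgn_injective (smul_left_injective ℂ (unitary_ne_zero _) (h3.symm.trans h4))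

theorem weyl_injective (n : ℕ) : Function.Injective (weyl n) := by
  have key : ∀ x, weyl n x = 1 → x = 0 := by
    intro x hx
    rw [← weyl_zero, weyl, weyl, eq_comm, cls_eq_iff] at hx
    obtain ⟨z, hz⟩ := hx
    refine form_eq_zero n x fun y => ?_
    have h0 : ∀ y, form n 0 y = 0 := fun y => by simp [form]
    rw [← h0 y]
    refine form_eq_of_conj n 1 x y 0 y z 1 ?_ ?_
    · simpa using hz
    · simp
  intro x y hxy
  have h := weyl_add n x (-y)
  rw [hxy, ← weyl_add, add_neg_cancel, weyl_zero] at h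
  exact sub_eq_zero.mp (by rw [sub_eq_add_neg]; exact key _ h)

theorem pauliOne_eq (P : Matrix.unitaryGroup (Fin 2) ℂ) (hP : P ∈ pauliOne) :
    ∃ (c : ℂ) (p q : ZMod 2), (P : Matrix (Fin 2) (Fin 2) ℂ) = c • weylOne p q := by
  induction hP using Subgroup.closure_induction with
  | mem P h =>
    rcases h with rfl | rfl | rfl
    · exact ⟨1, 0, 1, by simp [weylOne, pauliX, ZMod.val_one]⟩
    · exact ⟨1, 1, 0, by simp [weylOne, pauliZ, ZMod.val_one]⟩
    · exact ⟨Complex.I, 0, 0, by simp [weylOne, scalarI]⟩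
  | one => exact ⟨1, 0, 0, by simp [weylOne]⟩
  | mul P Q _ _ ihP ihQ =>
    obtain ⟨c, p, q, h⟩ := ihP
    obtain ⟨d, p', q', h'⟩ := ihQ
    refine ⟨d * c * sgn (q * p'), p + p', q + q', ?_⟩
    rw [Matrix.UnitaryGroup.mul_val, h, h', Matrix.mul_smul, Matrix.smul_mul, weylOne_mul,
      smul_smul, smul_smul]
  | inv P _ ih =>
    obtain ⟨c, p, q, h⟩ := ih
    refine ⟨star c * sgn (q * p), p, q, ?_⟩
    rw [Matrix.UnitaryGroup.inv_val, h]
    rcases zmod_two_cases p with rfl | rfl <;> rcases zmod_two_cases q with rfl | rfl <;>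
      ext i j <;> fin_cases i <;> fin_cases j <;>
      simp [weylOne, matX, matZ, ZMod.val_one, sgn_zero, sgn_one, Matrix.star_apply]

theorem exists_weyl (n : ℕ) (c : ProjClifford n) (hc : c ∈ projPauli n) :
    ∃ x, c = weyl n x := by
  obtain ⟨⟨U, hU⟩, ⟨A, hA, hAU⟩, rfl⟩ := hc
  have hA' : ∀ i, A i ∈ pauliOne := fun i => (Subgroup.mem_pi _).mp hA i trivial
  choose z p q h using fun i => pauliOne_eq (A i) (hA' i)
  refine ⟨Sum.elim p q, ?_⟩
  rw [weyl, eq_comm, cls_eq_iff]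
  refine ⟨∏ i, z i, ?_⟩
  have hAU' : tensorU n A = U := hAU
  simp only [← hAU', coe_tensorU, h, tensorMat_smul]
  rfl

theorem conj_weyl_iff (n : ℕ) (U : ↥(clifford n)) (x y : Vec n) :
    cls n U * weyl n x * (cls n U)⁻¹ = weyl n y ↔
      ∃ z : ℂ, ((U : UnitaryOp n) : Op n) * weylU n x =
        z • ((weylU n y : Op n) * ((U : UnitaryOp n) : Op n)) := by
  rw [mul_inv_eq_iff_eq_mul, weyl, weyl, ← map_mul, ← map_mul, eq_comm, cls_eq_iff]
  rfl

theorem form_eq_dotProduct (n : ℕ) (x y : Vec n) :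
    form n x y = x ⬝ᵥ (Matrix.J (Fin n) (ZMod 2) *ᵥ y) := by
  simp [form, Matrix.J, dotProduct, Fintype.sum_sum_type, Matrix.mulVec, Matrix.one_apply,
    Matrix.fromBlocks, Finset.sum_add_distrib, Matrix.neg_apply, sub_eq_add_neg, CharTwo.neg_eq]

/-- A class of Clifford operators acts on `ℤ₂^{2n}` by a symplectic matrix. -/
theorem exists_symplectic (n : ℕ) (c : ProjClifford n) :
    ∃ Γ : Sp n, ∀ x, c * weyl n x * c⁻¹ =
      weyl n ((Γ : Matrix (Fin n ⊕ Fin n) (Fin n ⊕ Fin n) (ZMod 2)) *ᵥ x) := by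
  choose g hg using fun x => exists_weyl n (c * weyl n x * c⁻¹)
    ((projPauli_normal n).conj_mem _ (weyl_mem_projPauli n x) c)
  have hadd : ∀ x y, g (x + y) = g x + g y := by
    intro x y
    apply weyl_injective n
    rw [weyl_add, ← hg, ← hg, ← hg, weyl_add]
    group
  have hform : ∀ x y, form n (g x) (g y) = form n x y := by
    intro x y
    obtain ⟨U, rfl⟩ := QuotientGroup.mk'_surjective _ c
    obtain ⟨z, hz⟩ := (conj_weyl_iff n U x (g x)).mp (hg x)
    obtain ⟨w, hw⟩ := (conj_weyl_iff n U y (g y)).mp (hg y)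
    exact (form_eq_of_conj n U x y _ _ z w hz hw).symm
  let L : Vec n →ₗ[ZMod 2] Vec n := AddMonoidHom.toZModLinearMap 2 (AddMonoidHom.mk' g hadd)
  have hL : ∀ x, LinearMap.toMatrix' L *ᵥ x = g x := fun x => by
    rw [← Matrix.toLin'_apply, Matrix.toLin'_toMatrix']
    rfl
  refine ⟨⟨LinearMap.toMatrix' L, ?_⟩, fun x => by rw [hg]; congr 1; exact (hL x).symm⟩
  rw [SymplecticGroup.mem_iff']
  ext i j
  have h := hform (Pi.single i 1) (Pi.single j 1)
  rw [form_eq_dotProduct, form_eq_dotProduct, ← hL, ← hL, Matrix.mulVec_mulVec,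
    ← Matrix.vecMul_transpose, ← Matrix.dotProduct_mulVec, Matrix.mulVec_mulVec] at h
  simpa [← mul_assoc] using h

theorem symplectic_ext (n : ℕ) (Γ Δ : Sp n)
    (h : ∀ x, (Γ : Matrix (Fin n ⊕ Fin n) (Fin n ⊕ Fin n) (ZMod 2)) *ᵥ x = Δ.1 *ᵥ x) : Γ = Δ :=
  Subtype.ext (Matrix.ext_of_mulVec_single fun _ => h _)

/-- The action of the projective Clifford group on `ℤ₂^{2n}`: the class of `U` goes to the
symplectic matrix `Γ` such that `U W_x U⁻¹` equals `W_(Γ x)` up to a phase, for all `x`. -/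
noncomputable def cliffordAction (n : ℕ) : ProjClifford n →* Sp n :=
  MonoidHom.mk' (fun c => Classical.choose (exists_symplectic n c)) fun c d => by
    apply symplectic_ext
    intro x
    apply weyl_injective n
    rw [← Classical.choose_spec (exists_symplectic n (c * d)), Submonoid.coe_mul,
      ← Matrix.mulVec_mulVec, ← Classical.choose_spec (exists_symplectic n c),
      ← Classical.choose_spec (exists_symplectic n d)]
    group

theorem cliffordAction_spec (n : ℕ) (c : ProjClifford n) (x : Vec n) :
    c * weyl n x * c⁻¹ = weyl n ((cliffordAction n c).1 *ᵥ x) :=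
  Classical.choose_spec (exists_symplectic n c) x

theorem cliffordAction_eq_one (n : ℕ) (c : ProjClifford n) (hc : c ∈ projPauli n) :
    cliffordAction n c = 1 := by
  obtain ⟨y, rfl⟩ := exists_weyl n c hc
  apply symplectic_ext
  intro x
  apply weyl_injective n
  rw [← cliffordAction_spec, ← weyl_add, add_comm, weyl_add, mul_inv_cancel_right,
    Submonoid.coe_one, Matrix.one_mulVec]

/-- The action of `IN_n / ℤ₂^{2n}` on `ℤ₂^{2n}` by symplectic matrices, `n = m + 1`. -/
noncomputable def inertiaAction (m : ℕ) : InertiaQuotient m →* Sp (m + 1) :=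
  QuotientGroup.lift _ ((cliffordAction (m + 1)).comp (IN m).subtype)
    fun c hc => cliffordAction_eq_one (m + 1) c hc

/-- The group `(IN_n / ℤ₂^{2n}) ⋉ ℤ₂^{2n}`, `n = m + 1`. -/
abbrev InertiaAffine (m : ℕ) : Type :=
  Multiplicative (Vec (m + 1)) ⋊[(spAction (m + 1)).comp (inertiaAction m)] InertiaQuotient m

/-- The natural map from `(IN_n / ℤ₂^{2n}) ⋉ ℤ₂^{2n}` to `Sp(2n, 2) ⋉ ℤ₂^{2n}`, `n = m + 1`. -/
noncomputable def inertiaIncl (m : ℕ) : InertiaAffine m →* AffineSp (m + 1) :=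
  SemidirectProduct.map (MonoidHom.id _) (inertiaAction m) fun _ => rfl

/-! ### Commutation with `Z₁X₁` -/

theorem onQubit_mul (n : ℕ) (j : Fin n) (A B : Matrix (Fin 2) (Fin 2) ℂ) :
    onQubit n j (A * B) = onQubit n j A * onQubit n j B := by
  rw [onQubit, Pi.mulSingle_mul, map_mul]
  rfl

theorem onQubit_comm (n : ℕ) {j k : Fin n} (h : j ≠ k) (A B : Matrix (Fin 2) (Fin 2) ℂ) :
    onQubit n j A * onQubit n k B = onQubit n k B * onQubit n j A := by
  rw [onQubit, onQubit, ← map_mul, ← map_mul]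
  congr 1
  funext i
  by_cases hj : i = j
  · subst hj
    simp [h]
  · simp [hj]

theorem onQubit_apply (n : ℕ) (j : Fin n) (A : Matrix (Fin 2) (Fin 2) ℂ) (x y : Fin n → Fin 2) :
    onQubit n j A x y = if ∀ k, k ≠ j → x k = y k then A (x j) (y j) else 0 := by
  rw [onQubit, tensorMat_apply]
  split_ifs with h
  · rw [Finset.prod_eq_single j]
    · simp
    · intro k _ hk
      rw [Pi.mulSingle_eq_of_ne hk, h k hk, Matrix.one_apply_eq]
    · simp
  · push Not at h
    obtain ⟨k, hk, hxy⟩ := h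
    refine Finset.prod_eq_zero (Finset.mem_univ k) ?_
    rw [Pi.mulSingle_eq_of_ne hk, Matrix.one_apply_ne hxy]

theorem onQubit_smul (n : ℕ) (j : Fin n) (c : ℂ) (A : Matrix (Fin 2) (Fin 2) ℂ) :
    onQubit n j (c • A) = c • onQubit n j A := by
  ext x y
  simp only [onQubit_apply, Matrix.smul_apply]
  split_ifs <;> simp

/-- The matrix of a map between basis vectors. -/
def mapOp (n : ℕ) (f : (Fin n → Fin 2) → (Fin n → Fin 2)) : Op n :=
  Matrix.of fun x y => if x = f y then 1 else 0

theorem mapOp_mul (n : ℕ) (f g : (Fin n → Fin 2) → (Fin n → Fin 2)) :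
    mapOp n f * mapOp n g = mapOp n (f ∘ g) := by
  ext x y
  simp [mapOp, Matrix.mul_apply]

theorem mapOp_mul_diagonal (n : ℕ) (f : (Fin n → Fin 2) → (Fin n → Fin 2))
    (d : (Fin n → Fin 2) → ℂ) (h : ∀ y, d (f y) = d y) :
    mapOp n f * Matrix.diagonal d = Matrix.diagonal d * mapOp n f := by
  ext x y
  rw [Matrix.mul_diagonal, Matrix.diagonal_mul]
  by_cases hx : x = f y
  · subst hx
    rw [h, mul_comm]
  · simp [mapOp, hx]

theorem onQubit_matX (n : ℕ) (j : Fin n) :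
    onQubit n j matX = mapOp n fun y => Function.update y j (y j + 1) := by
  ext x y
  rw [onQubit_apply, mapOp, Matrix.of_apply]
  have hX : ∀ a b : Fin 2, matX a b = if a = b + 1 then 1 else 0 := by
    intro a b
    fin_cases a <;> fin_cases b <;> simp [matX]
  rw [hX, ← ite_and]
  congr 1
  rw [Function.eq_update_iff, and_comm]

theorem onQubit_matZ (n : ℕ) (j : Fin n) :
    onQubit n j matZ = Matrix.diagonal fun y => if y j = 0 then (1 : ℂ) else -1 := by
  ext x y
  rw [onQubit_apply, Matrix.diagonal_apply]
  have hZ : ∀ a b : Fin 2, matZ a b = if a = b then (if a = 0 then 1 else -1) else 0 := by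
    intro a b
    fin_cases a <;> fin_cases b <;> simp [matZ]
  rw [hZ, ← ite_and]
  congr 1
  rw [eq_iff_iff]
  constructor
  · rintro ⟨h1, h2⟩
    funext k
    by_cases hk : k = j
    · rw [hk, h2]
    · exact h1 k hk
  · rintro rfl
    simp

theorem gateCX_eq (n : ℕ) (c t : Fin n) :
    gateCX n c t = mapOp n fun y => Function.update y t (y t + y c) := rfl

theorem gateCX_matZ (n : ℕ) {c t : Fin n} (h : c ≠ t) :
    gateCX n c t * onQubit n c matZ = onQubit n c matZ * gateCX n c t := by
  rw [onQubit_matZ, gateCX_eq, mapOp_mul_diagonal]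
  intro y
  rw [Function.update_of_ne h]

theorem gateCX_matX (n : ℕ) {c t : Fin n} (h : c ≠ t) :
    gateCX n c t * onQubit n c matX = onQubit n c matX * onQubit n t matX * gateCX n c t := by
  rw [onQubit_matX, onQubit_matX, gateCX_eq, mapOp_mul, mapOp_mul, mapOp_mul]
  congr 1
  funext y k
  by_cases hc : k = c
  · subst hc
    simp [h]
  · by_cases ht : k = t
    · subst ht
      simp only [Function.comp_apply, Function.update_self, Function.update_of_ne h,
        Function.update_of_ne h.symm]
      omega
    · simp [hc, ht]

theorem gateCX_matX_target (n : ℕ) {c t : Fin n} (h : c ≠ t) :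
    gateCX n c t * onQubit n t matX = onQubit n t matX * gateCX n c t := by
  rw [onQubit_matX, gateCX_eq, mapOp_mul, mapOp_mul]
  congr 1
  funext y k
  by_cases ht : k = t
  · subst ht
    simp [h, add_assoc, add_comm]
  · simp [ht]

theorem matX_mul_matX : matX * matX = 1 := by
  ext i j
  fin_cases i <;> fin_cases j <;> simp [matX, Matrix.mul_apply, Fin.sum_univ_two]

theorem onQubit_one (n : ℕ) (j : Fin n) : onQubit n j 1 = 1 := by
  rw [onQubit, Pi.mulSingle_one, map_one]

theorem matX_comm : matX * (matZ * matX) = (-1 : ℂ) • ((matZ * matX) * matX) := by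
  ext i j
  fin_cases i <;> fin_cases j <;> simp [matX, matZ, Matrix.mul_apply, Fin.sum_univ_two]

theorem matH_comm : matH * (matZ * matX) = (-1 : ℂ) • ((matZ * matX) * matH) := by
  ext i j
  fin_cases i <;> fin_cases j <;> simp [matX, matZ, matH, Matrix.mul_apply, Fin.sum_univ_two]

theorem matZ_comm : matZ * (matZ * matX) = (-1 : ℂ) • ((matZ * matX) * matZ) := by
  ext i j
  fin_cases i <;> fin_cases j <;> simp [matX, matZ, Matrix.mul_apply, Fin.sum_univ_two]

theorem gateM_comm (m : ℕ) (t : Fin (m + 1)) (ht : t.val = 1) :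
    gateM m t * onQubit (m + 1) 0 (matZ * matX) =
      onQubit (m + 1) 0 (matZ * matX) * gateM m t := by
  have h0 : (0 : Fin (m + 1)) ≠ t := by
    rintro rfl
    simp at ht
  have hCX : gateCX (m + 1) 0 t * onQubit (m + 1) 0 (matZ * matX) =
      onQubit (m + 1) 0 (matZ * matX) * onQubit (m + 1) t matX * gateCX (m + 1) 0 t := by
    rw [onQubit_mul, ← mul_assoc, gateCX_matZ _ h0, mul_assoc, gateCX_matX _ h0]
    simp only [mul_assoc]
  have hZH : onQubit (m + 1) 0 matZ * onQubit (m + 1) 0 matH * onQubit (m + 1) 0 (matZ * matX) =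
      onQubit (m + 1) 0 (matZ * matX) *
        (onQubit (m + 1) 0 matZ * onQubit (m + 1) 0 matH) := by
    simp only [← onQubit_mul]
    congr 1
    rw [mul_assoc, matH_comm, Matrix.mul_smul, ← mul_assoc, matZ_comm, Matrix.smul_mul, smul_smul]
    simp [mul_assoc]
  have hXX : onQubit (m + 1) t matX * onQubit (m + 1) t matX = 1 := by
    rw [← onQubit_mul, matX_mul_matX, onQubit_one]
  have hX0 := fun A => onQubit_comm (m + 1) h0 A matX
  have hPX := onQubit_comm (m + 1) h0 (matZ * matX) matX
  have hXt := gateCX_matX_target (m + 1) h0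
  rw [gateM]
  generalize gateCX (m + 1) 0 t = C at *
  generalize onQubit (m + 1) 0 (matZ * matX) = P at *
  set G := onQubit (m + 1) 0 matZ * onQubit (m + 1) 0 matH
  have hGX : G * onQubit (m + 1) t matX = onQubit (m + 1) t matX * G := by
    rw [mul_assoc, hX0, ← mul_assoc, hX0, mul_assoc]
  generalize onQubit (m + 1) t matX = T at *
  calc C * (G * T) * C * P = C * (G * T) * (C * P) := by rw [mul_assoc]
    _ = C * G * (T * P) * T * C := by rw [hCX]; simp only [mul_assoc]
    _ = C * (G * P) * (T * T) * C := by rw [← hPX]; simp only [mul_assoc]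
    _ = C * P * G * C := by rw [hXX, hZH]; simp only [mul_assoc, mul_one]
    _ = P * T * (C * G) * C := by rw [hCX]; simp only [mul_assoc]
    _ = P * (C * T) * G * C := by rw [hXt]; simp only [mul_assoc]
    _ = P * (C * (G * T) * C) := by rw [hGX]; simp only [mul_assoc]

theorem onQubit_zero_apply (m : ℕ) (B : Matrix (Fin 2) (Fin 2) ℂ) (x y : Fin (m + 1) → Fin 2) :
    onQubit (m + 1) 0 B x y = B (x 0) (y 0) * (1 : Op m) (Fin.tail x) (Fin.tail y) := by
  rw [onQubit, tensorMat_apply, Fin.prod_univ_succ, ← map_one (tensorMat m), tensorMat_apply]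
  simp only [Pi.mulSingle_eq_same, Pi.mulSingle_eq_of_ne (Fin.succ_ne_zero _)]
  rfl

theorem idTensor_comm (m : ℕ) (A : Op m) (B : Matrix (Fin 2) (Fin 2) ℂ) :
    idTensor m A * onQubit (m + 1) 0 B = onQubit (m + 1) 0 B * idTensor m A := by
  ext x y
  rw [Matrix.mul_apply, Matrix.mul_apply,
    ← (Fin.consEquiv fun _ : Fin (m + 1) => Fin 2).sum_comp, Fintype.sum_prod_type,
    ← (Fin.consEquiv fun _ : Fin (m + 1) => Fin 2).sum_comp, Fintype.sum_prod_type]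
  simp [onQubit_zero_apply, idTensor, Fin.consEquiv, Matrix.one_apply, mul_comm]

/-! ### The character `σ₁`, its extension and the induced representations -/

/-- The vector `x` with `[W_x] = [Z₁X₁]`. -/
def vecY (m : ℕ) : Vec (m + 1) := Pi.single (Sum.inl 0) 1 + Pi.single (Sum.inr 0) 1

theorem coe_weylU_vecY (m : ℕ) :
    (weylU (m + 1) (vecY m) : Op (m + 1)) = onQubit (m + 1) 0 (matZ * matX) := by
  rw [coe_weylU, onQubit]
  congr 1
  funext i
  by_cases hi : i = 0
  · subst hi
    simp [vecY, weylOne, ZMod.val_one]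
  · simp [vecY, weylOne, hi]

theorem comm_weyl_vecY (m : ℕ) (c : ProjClifford (m + 1)) (hc : c ∈ IN m) :
    c * weyl (m + 1) (vecY m) * c⁻¹ = weyl (m + 1) (vecY m) := by
  have hle : IN m ≤ Subgroup.centralizer {weyl (m + 1) (vecY m)} := by
    rw [IN, Subgroup.closure_le]
    rintro c ⟨U, hU, rfl⟩
    rw [SetLike.mem_coe, Subgroup.mem_centralizer_singleton_iff, ← mul_inv_eq_iff_eq_mul,
      conj_weyl_iff, coe_weylU_vecY]
    rcases hU with ⟨t, ht, hU⟩ | hU | hU | ⟨A, _, hU⟩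
    · exact ⟨1, by rw [hU, gateM_comm m t ht, one_smul]⟩
    · exact ⟨-1, by rw [hU, ← onQubit_mul, ← onQubit_mul, ← onQubit_smul, matH_comm]⟩
    · exact ⟨-1, by rw [hU, ← onQubit_mul, ← onQubit_mul, ← onQubit_smul, matX_comm]⟩
    · exact ⟨1, by rw [hU, idTensor_comm, one_smul]⟩
  rw [mul_inv_eq_iff_eq_mul]
  exact Subgroup.mem_centralizer_singleton_iff.mp (hle hc)

theorem form_symplectic (n : ℕ) (Γ : Sp n) (x y : Vec n) :
    form n (Γ.1 *ᵥ x) (Γ.1 *ᵥ y) = form n x y := by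
  rw [form_eq_dotProduct, form_eq_dotProduct, Matrix.mulVec_mulVec, ← Matrix.vecMul_transpose,
    ← Matrix.dotProduct_mulVec, Matrix.mulVec_mulVec, ← mul_assoc,
    SymplecticGroup.mem_iff'.mp Γ.2]

/-- The nontrivial irreducible character `σ₁` of `ℤ₂^{2n}`, `n = m + 1`: it is `-1` at `[X₁]` and
`[Z₁]`, and `1` at `[X_i]` and `[Z_i]` for the other `i`. -/
def sigmaOne (m : ℕ) : Multiplicative (Vec (m + 1)) →* ℂ where
  toFun x := sgn (x.toAdd (Sum.inl 0) + x.toAdd (Sum.inr 0))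
  map_one' := by simp [sgn_zero]
  map_mul' x y := by
    rw [← sgn_add, toAdd_mul, Pi.add_apply, Pi.add_apply, add_add_add_comm]

theorem sigmaOne_eq (m : ℕ) (x : Multiplicative (Vec (m + 1))) :
    sigmaOne m x = sgn (form (m + 1) x.toAdd (vecY m)) := by
  simp [sigmaOne, form, vecY, Pi.single_apply, Finset.sum_add_distrib, sub_eq_add_neg,
    CharTwo.neg_eq]

theorem sigmaOne_invariant (m : ℕ) (c : InertiaQuotient m) (x : Multiplicative (Vec (m + 1))) :
    sigmaOne m (spAction (m + 1) (inertiaAction m c) x) = sigmaOne m x := by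
  obtain ⟨c, rfl⟩ := QuotientGroup.mk_surjective c
  have h : (inertiaAction m c).1 *ᵥ vecY m = vecY m := by
    apply weyl_injective
    exact (cliffordAction_spec (m + 1) c (vecY m)).symm.trans (comm_weyl_vecY m c c.2)
  rw [sigmaOne_eq, sigmaOne_eq]
  conv_lhs => rw [← h]
  exact congrArg sgn (form_symplectic _ _ _ _)

/-- The extension `σ₁''` of `σ₁` to `(IN_n / ℤ₂^{2n}) ⋉ ℤ₂^{2n}`, `n = m + 1`, given by
`σ₁''(x, Γ) = σ₁(x)`. -/
noncomputable def sigmaOneExt (m : ℕ) : InertiaAffine m →* ℂ where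
  toFun g := sigmaOne m g.left
  map_one' := map_one (sigmaOne m)
  map_mul' g h := by
    rw [SemidirectProduct.mul_left, map_mul]
    congr 1
    exact sigmaOne_invariant m g.right h.left

/-- The one-dimensional representation given by a multiplicative character. -/
noncomputable def charRep {G : Type*} [Group G] (χ : G →* ℂ) : Representation ℂ G ℂ :=
  ((Algebra.lmul ℂ ℂ : ℂ →ₐ[ℂ] Module.End ℂ ℂ) : ℂ →* Module.End ℂ ℂ).comp χ

/-- The representation of `Sp(2n, 2) ⋉ ℤ₂^{2n}` induced from the representation `σ₁'' ⊗ ψ̃` of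
`(IN_n / ℤ₂^{2n}) ⋉ ℤ₂^{2n}`, `n = m + 1`, where `ψ̃` is the inflation of `ψ`. -/
noncomputable def inducedRep (m : ℕ) {W : Type u} [AddCommGroup W] [Module ℂ W]
    (ψ : Representation ℂ (InertiaQuotient m) W) :
    Representation ℂ (AffineSp (m + 1))
      (Representation.IndV (inertiaIncl m)
        ((charRep (sigmaOneExt m)).tprod (ψ.comp SemidirectProduct.rightHom))) :=
  Representation.ind (inertiaIncl m)
    ((charRep (sigmaOneExt m)).tprod (ψ.comp SemidirectProduct.rightHom))

/-- The inflation to `Sp(2n, 2) ⋉ ℤ₂^{2n}` of a representation of `Sp(2n, 2)`. -/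
def inflatedRep (n : ℕ) {W : Type u} [AddCommGroup W] [Module ℂ W]
    (ψ : Representation ℂ (Sp n) W) : Representation ℂ (AffineSp n) W :=
  ψ.comp SemidirectProduct.rightHom

/-- The conjugate `ᵍσ(n) = σ(g⁻¹ n g)` of a representation `σ` of a normal subgroup. -/
def conjRep {G : Type*} [Group G] {N : Subgroup G} [N.Normal] {V : Type*} [AddCommGroup V]
    [Module ℂ V] (σ : Representation ℂ N V) (g : G) : Representation ℂ N V :=
  σ.comp (MulAut.conjNormal g⁻¹ : MulAut N).toMonoidHom

theorem conjRep_equiv_iff {G : Type*} [Group G] {N : Subgroup G} [N.Normal] {V : Type*}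
    [AddCommGroup V] [Module ℂ V] (σ : Representation ℂ N V) (g : G) :
    Nonempty ((conjRep σ g).Equiv σ) ↔
      ∃ L : V ≃ₗ[ℂ] V, ∀ n v, L (σ (MulAut.conjNormal g⁻¹ n) v) = σ n (L v) :=
  ⟨fun ⟨e⟩ => ⟨e.toLinearEquiv, fun n v => LinearMap.congr_fun (e.isIntertwining' n) v⟩,
    fun ⟨L, hL⟩ => ⟨Representation.Equiv.mk L fun n => LinearMap.ext (hL n)⟩⟩

/-- The inertia subgroup of a representation `σ` of a normal subgroup: the `g` with `ᵍσ`
equivalent to `σ`. -/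
def inertiaSubgroup {G : Type*} [Group G] {N : Subgroup G} [N.Normal] {V : Type*} [AddCommGroup V]
    [Module ℂ V] (σ : Representation ℂ N V) : Subgroup G where
  carrier := {g | Nonempty ((conjRep σ g).Equiv σ)}
  one_mem' := (conjRep_equiv_iff σ 1).mpr ⟨LinearEquiv.refl ℂ V, fun n v => by simp⟩
  mul_mem' := by
    intro g h hg hh
    obtain ⟨L, hL⟩ := (conjRep_equiv_iff σ g).mp hg
    obtain ⟨M, hM⟩ := (conjRep_equiv_iff σ h).mp hh
    refine (conjRep_equiv_iff σ (g * h)).mpr ⟨M.trans L, fun n v => ?_⟩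
    rw [_root_.mul_inv_rev, map_mul, MulAut.mul_apply, LinearEquiv.trans_apply, LinearEquiv.trans_apply,
      hM, hL]
  inv_mem' := by
    intro g hg
    obtain ⟨L, hL⟩ := (conjRep_equiv_iff σ g).mp hg
    refine (conjRep_equiv_iff σ g⁻¹).mpr ⟨L.symm, fun n v => ?_⟩
    have h := hL (MulAut.conjNormal g n) (L.symm v)
    rw [← MulAut.mul_apply, ← map_mul, inv_mul_cancel, map_one, MulAut.one_apply,
      LinearEquiv.apply_symm_apply] at h
    rw [LinearEquiv.symm_apply_eq, h, inv_inv]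

/-- The normal subgroup `ℤ₂^{2n}` of `Sp(2n, 2) ⋉ ℤ₂^{2n}`. -/
def translations (n : ℕ) : Subgroup (AffineSp n) := (SemidirectProduct.inl).range

instance translations_normal (n : ℕ) : (translations n).Normal := by
  rw [translations, SemidirectProduct.range_inl_eq_ker_rightHom]
  infer_instance

/-- `σ₁` as a representation of the normal subgroup `ℤ₂^{2n}` of `Sp(2n, 2) ⋉ ℤ₂^{2n}`,
`n = m + 1`. -/
noncomputable def sigmaOneRep (m : ℕ) : Representation ℂ (translations (m + 1)) ℂ :=
  charRep ((sigmaOne m).comp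
    (MonoidHom.ofInjective (f := (SemidirectProduct.inl : _ →* AffineSp (m + 1)))
      SemidirectProduct.inl_injective).symm.toMonoidHom)

end CliffordLift

namespace CliffordLift

/-! ### The symplectic form and transvections -/

/-! Every character of `ℤ₂^{2n}` has the form `x ↦ (-1)^[x, y]`, and `σ₁` is the one with `y =
vecY`, the vector of `Z₁X₁`. An element of `G` acts on these labels `y` by its symplectic part.
Transvections act transitively on nonzero vectors, so there are two orbits of labels: zero and
everything else. The theorem is the little-group method for these two orbits, once the stabilizer of
`vecY` is known to be `IN_n / ℤ₂^{2n}`.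

The stabilizer is found in `mem_inertiaImage_iff`. The generators of `IN_n` commute with `Z₁X₁` up
to phase, so their images fix `vecY`. Conversely, up to Pauli factors `H₁` and `M` are `(1 +
W_v)/√2` for `v = vecY` and `v = vecY + [X₂]`, and such operators act as transvections; the
operators `I ⊗ A` supply all of `Sp(2n-2, 2)`, since Clifford operators realize every symplectic
matrix (`cliffordAction_surjective`). These move `[X₁]` to any vector pairing to 1 with `vecY`. A
stabilizing matrix corrected in this way fixes both `vecY` and `[X₁]`, hence the whole first qubit,
and comes from the other qubits. Injectivity of `ι` holds because a Clifford operator acting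
trivially on vectors is a Pauli up to phase (`mem_projPauli_of_cliffordAction_eq_one`).

On the representation side, averaging over the finite group `ℤ₂^{2n}` splits any representation, of
any dimension, into weight spaces permuted by `G`. If an irreducible representation has no weight
`vecY`, it has no nonzero weight, so translations act trivially and it is inflated. Otherwise its
`vecY` weight space is an irreducible `ψ` of the inertia quotient; Frobenius reciprocity and Schur's
lemma identify the representation with the one induced from `σ₁'' ⊗ ψ̃`. Conversely the `vecY`
weight space of an induced representation is exactly the copy of `ψ`, and its zero weight space
vanishes. This gives irreducibility, recovers `ψ` and separates the two families. -/

theorem form_add_left (n : ℕ) (x y z : Vec n) : form n (x + y) z = form n x z + form n y z := by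
  rw [form, form, form, ← Finset.sum_add_distrib]
  refine Finset.sum_congr rfl fun i _ => ?_
  simp only [Pi.add_apply]
  ring

theorem form_add_right (n : ℕ) (x y z : Vec n) : form n x (y + z) = form n x y + form n x z := by
  rw [form, form, form, ← Finset.sum_add_distrib]
  refine Finset.sum_congr rfl fun i _ => ?_
  simp only [Pi.add_apply]
  ring

theorem form_smul_left (n : ℕ) (a : ZMod 2) (x y : Vec n) :
    form n (a • x) y = a * form n x y := by
  rw [form, form, Finset.mul_sum]
  refine Finset.sum_congr rfl fun i _ => ?_
  simp only [Pi.smul_apply, smul_eq_mul]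
  ring

theorem form_smul_right (n : ℕ) (a : ZMod 2) (x y : Vec n) :
    form n x (a • y) = a * form n x y := by
  rw [form, form, Finset.mul_sum]
  refine Finset.sum_congr rfl fun i _ => ?_
  simp only [Pi.smul_apply, smul_eq_mul]
  ring

theorem form_self (n : ℕ) (x : Vec n) : form n x x = 0 :=
  Finset.sum_eq_zero fun i _ => by ring

theorem form_comm (n : ℕ) (x y : Vec n) : form n x y = form n y x := by
  refine Finset.sum_congr rfl fun i _ => ?_
  rw [CharTwo.sub_eq_add, CharTwo.sub_eq_add]
  ring

theorem form_zero_left (n : ℕ) (x : Vec n) : form n 0 x = 0 := by simp [form]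

theorem vec_add_self {n : ℕ} (x : Vec n) : x + x = 0 :=
  funext fun i => CharTwo.add_self_eq_zero (x i)

theorem form_eq_of_forall {n : ℕ} {x y : Vec n} (h : ∀ z, form n x z = form n y z) : x = y := by
  have hxy : x + y = 0 := form_eq_zero n _ fun z => by
    rw [form_add_left, h, CharTwo.add_self_eq_zero]
  rw [← add_zero x, ← vec_add_self y, ← add_assoc, hxy, zero_add]

/-- Over `ZMod 2` an additive map is linear, and preservation of the form, tested on basis vectors,
is the matrix equation defining the symplectic group. -/
theorem exists_sp_of_isometry (n : ℕ) (g : Vec n → Vec n) (hadd : ∀ x y, g (x + y) = g x + g y)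
    (hform : ∀ x y, form n (g x) (g y) = form n x y) : ∃ Γ : Sp n, ∀ x, Γ.1 *ᵥ x = g x := by
  let L : Vec n →ₗ[ZMod 2] Vec n := AddMonoidHom.toZModLinearMap 2 (AddMonoidHom.mk' g hadd)
  have hL : ∀ x, LinearMap.toMatrix' L *ᵥ x = g x := fun x => by
    rw [← Matrix.toLin'_apply, Matrix.toLin'_toMatrix']
    rfl
  refine ⟨⟨LinearMap.toMatrix' L, ?_⟩, hL⟩
  rw [SymplecticGroup.mem_iff']
  ext i j
  have h := hform (Pi.single i 1) (Pi.single j 1)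
  rw [form_eq_dotProduct, form_eq_dotProduct, ← hL, ← hL, Matrix.mulVec_mulVec,
    ← Matrix.vecMul_transpose, ← Matrix.dotProduct_mulVec, Matrix.mulVec_mulVec] at h
  simpa [← mul_assoc] using h

theorem sp_mul_mulVec {n : ℕ} (Γ Δ : Sp n) (x : Vec n) :
    (Γ * Δ).1 *ᵥ x = Γ.1 *ᵥ (Δ.1 *ᵥ x) := by
  rw [Submonoid.coe_mul, Matrix.mulVec_mulVec]

theorem sp_one_mulVec {n : ℕ} (x : Vec n) : (1 : Sp n).1 *ᵥ x = x := by
  rw [Submonoid.coe_one, Matrix.one_mulVec]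

theorem sp_inv_mulVec_eq_iff {n : ℕ} (Γ : Sp n) (x y : Vec n) :
    (Γ⁻¹).1 *ᵥ x = y ↔ x = Γ.1 *ᵥ y := by
  constructor
  · rintro rfl
    rw [← sp_mul_mulVec, mul_inv_cancel, sp_one_mulVec]
  · rintro rfl
    rw [← sp_mul_mulVec, inv_mul_cancel, sp_one_mulVec]

/-- The form is preserved because `[v, v] = 0` and the two cross terms, both `[x, v][y, v]`, cancel
in characteristic 2. -/
theorem exists_transvection (n : ℕ) (v : Vec n) :
    ∃ Γ : Sp n, ∀ x, Γ.1 *ᵥ x = x + form n x v • v := by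
  refine exists_sp_of_isometry n _ (fun x y => ?_) fun x y => ?_
  · rw [form_add_left, add_smul]
    abel
  · simp only [form_add_left, form_add_right, form_smul_left, form_smul_right, form_self]
    rw [form_comm n v y]
    generalize form n x v = a, form n y v = b, form n x y = c
    revert a b c
    decide

/-- The symplectic transvection `x ↦ x + [x, v] v`. -/
noncomputable def transvection (n : ℕ) (v : Vec n) : Sp n :=
  Classical.choose (exists_transvection n v)

theorem transvection_apply {n : ℕ} (v x : Vec n) :
    (transvection n v).1 *ᵥ x = x + form n x v • v :=
  Classical.choose_spec (exists_transvection n v) x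

theorem transvection_apply_of_form_eq_zero {n : ℕ} {v x : Vec n} (h : form n x v = 0) :
    (transvection n v).1 *ᵥ x = x := by
  rw [transvection_apply, h, zero_smul, add_zero]

theorem transvection_apply_of_form_eq_one {n : ℕ} {v x : Vec n} (h : form n x v = 1) :
    (transvection n v).1 *ᵥ x = x + v := by
  rw [transvection_apply, h, one_smul]

theorem transvection_add_apply {n : ℕ} {u v : Vec n} (h : form n u v = 1) :
    (transvection n (u + v)).1 *ᵥ u = v := by
  rw [transvection_apply_of_form_eq_one, ← add_assoc, vec_add_self, zero_add]
  rw [form_add_right, form_self, h, zero_add]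

theorem exists_form_eq_one {n : ℕ} {v : Vec n} (hv : v ≠ 0) : ∃ w, form n v w = 1 := by
  by_contra! h
  exact hv (form_eq_zero n v fun y => (zmod_two_cases _).resolve_right (h y))

/-- Take `a` pairing to 1 with `u` and `b` pairing to 1 with `v`. If neither serves for both, each
is orthogonal to the other vector, and `a + b` works. -/
theorem exists_form_eq_one_and {n : ℕ} {u v : Vec n} (hu : u ≠ 0) (hv : v ≠ 0) :
    ∃ w, form n u w = 1 ∧ form n v w = 1 := by
  obtain ⟨a, ha⟩ := exists_form_eq_one hu
  obtain ⟨b, hb⟩ := exists_form_eq_one hv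
  rcases zmod_two_cases (form n v a) with h | h
  · rcases zmod_two_cases (form n u b) with h' | h'
    · exact ⟨a + b, by simp [form_add_right, *], by simp [form_add_right, *]⟩
    · exact ⟨b, h', hb⟩
  · exact ⟨a, ha, h⟩

/-- The subgroup of the symplectic group generated by the transvections. -/
noncomputable def transvectionGroup (n : ℕ) : Subgroup (Sp n) :=
  Subgroup.closure (Set.range (transvection n))

theorem transvection_mem {n : ℕ} (v : Vec n) : transvection n v ∈ transvectionGroup n :=
  Subgroup.subset_closure ⟨v, rfl⟩

/-- Transvections act transitively on the nonzero vectors. -/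
theorem exists_transvectionGroup_apply_eq {n : ℕ} {u v : Vec n} (hu : u ≠ 0) (hv : v ≠ 0) :
    ∃ Γ ∈ transvectionGroup n, Γ.1 *ᵥ u = v := by
  -- A vector pairing to 1 with both ends is an intermediate stop: one transvection for `u → w`,
  -- another for `w → v`.
  obtain ⟨w, huw, hvw⟩ := exists_form_eq_one_and hu hv
  refine ⟨_, mul_mem (transvection_mem (w + v)) (transvection_mem (u + w)), ?_⟩
  rw [sp_mul_mulVec, transvection_add_apply huw,
    transvection_add_apply ((form_comm n w v).trans hvw)]

/-- If `[v, v'] = 1`, the transvection at `v + v'` does it, since `u` is orthogonal to `v + v'`. If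
`[v, v'] = 0`, the transvection at `u` first replaces `v` by `v + u`, which pairs to 1 with `v'`. -/
theorem exists_transvectionGroup_fix_apply_eq {n : ℕ} {u v v' : Vec n} (h : form n u v = 1)
    (h' : form n u v' = 1) : ∃ Γ ∈ transvectionGroup n, Γ.1 *ᵥ u = u ∧ Γ.1 *ᵥ v = v' := by
  have h2 : (1 + 1 : ZMod 2) = 0 := by decide
  rcases zmod_two_cases (form n v v') with hv | hv
  · refine ⟨_, mul_mem (transvection_mem (v + u + v')) (transvection_mem u), ?_, ?_⟩
    · rw [sp_mul_mulVec, transvection_apply_of_form_eq_zero (form_self n u),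
        transvection_apply_of_form_eq_zero]
      rw [form_add_right, form_add_right, h, h', form_self, add_zero, h2]
    · rw [sp_mul_mulVec, transvection_apply_of_form_eq_one ((form_comm n v u).trans h),
        transvection_add_apply]
      rw [form_add_left, hv, h', zero_add]
  · refine ⟨_, transvection_mem (v + v'), ?_, transvection_add_apply hv⟩
    rw [transvection_apply_of_form_eq_zero]
    rw [form_add_right, h, h', h2]

/-- Transvections act transitively on the hyperbolic pairs. -/
theorem exists_transvectionGroup_apply_pair {n : ℕ} {u v u' v' : Vec n} (h : form n u v = 1)
    (h' : form n u' v' = 1) : ∃ Γ ∈ transvectionGroup n, Γ.1 *ᵥ u = u' ∧ Γ.1 *ᵥ v = v' := by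
  have hu : u ≠ 0 := by
    rintro rfl
    simp [form_zero_left] at h
  have hu' : u' ≠ 0 := by
    rintro rfl
    simp [form_zero_left] at h'
  obtain ⟨Γ, hΓ, hΓu⟩ := exists_transvectionGroup_apply_eq hu hu'
  have hv : form n u' (Γ.1 *ᵥ v) = 1 := by rw [← hΓu, form_symplectic, h]
  obtain ⟨Δ, hΔ, hΔu, hΔv⟩ := exists_transvectionGroup_fix_apply_eq hv h'
  exact ⟨Δ * Γ, mul_mem hΔ hΓ, by rw [sp_mul_mulVec, hΓu, hΔu], by rw [sp_mul_mulVec, hΔv]⟩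

/-! ### Clifford operators implementing a symplectic matrix -/

theorem weylU_zero (n : ℕ) : weylU n 0 = 1 := by
  have h : (weylU n 0 : Op n) = 1 := by
    rw [coe_weylU, ← map_one (tensorMat n)]
    congr 1
    funext i
    simp [weylOne]
  exact Subtype.ext h

theorem weylU_mul_self (n : ℕ) (x : Vec n) :
    (weylU n x : Op n) * weylU n x = sgn (∑ i, x (Sum.inr i) * x (Sum.inl i)) • 1 := by
  rw [weylU_mul, vec_add_self, weylU_zero, Matrix.UnitaryGroup.one_val]

theorem sgn_sq (a : ZMod 2) : sgn a ^ 2 = 1 := by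
  rcases zmod_two_cases a with rfl | rfl <;> simp [sgn_zero, sgn_one]

theorem sgn_mul_self (a : ZMod 2) : sgn a * sgn a = 1 := by
  rw [← sq, sgn_sq]

/-- Conjugation by `U` acts on the Weyl operators, up to phases, by the symplectic matrix `Γ`. -/
def Implements {n : ℕ} (U : UnitaryOp n) (Γ : Sp n) : Prop :=
  ∀ x, ∃ z : ℂ, (U : Op n) * weylU n x = z • ((weylU n (Γ.1 *ᵥ x) : Op n) * U)

theorem Implements.mul {n : ℕ} {U V : UnitaryOp n} {Γ Δ : Sp n} (hU : Implements U Γ)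
    (hV : Implements V Δ) : Implements (U * V) (Γ * Δ) := by
  intro x
  obtain ⟨z, hz⟩ := hV x
  obtain ⟨w, hw⟩ := hU (Δ.1 *ᵥ x)
  refine ⟨z * w, ?_⟩
  rw [Matrix.UnitaryGroup.mul_val, mul_assoc, hz, Matrix.mul_smul, ← mul_assoc, hw,
    Matrix.smul_mul, smul_smul, sp_mul_mulVec, mul_assoc]

theorem Implements.coeff_ne_zero {n : ℕ} {U : UnitaryOp n} {x y : Vec n} {z : ℂ}
    (h : (U : Op n) * weylU n x = z • ((weylU n y : Op n) * U)) : z ≠ 0 := by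
  rintro rfl
  rw [zero_smul, ← Matrix.UnitaryGroup.mul_val] at h
  exact unitary_ne_zero _ h

theorem unitary_mul_inv {n : ℕ} (U : UnitaryOp n) : (U : Op n) * (U⁻¹ : UnitaryOp n) = 1 := by
  rw [← Matrix.UnitaryGroup.mul_val, mul_inv_cancel, Matrix.UnitaryGroup.one_val]

theorem unitary_inv_mul {n : ℕ} (U : UnitaryOp n) : ((U⁻¹ : UnitaryOp n) : Op n) * U = 1 := by
  rw [← Matrix.UnitaryGroup.mul_val, inv_mul_cancel, Matrix.UnitaryGroup.one_val]

theorem Implements.inv {n : ℕ} {U : UnitaryOp n} {Γ : Sp n} (hU : Implements U Γ) :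
    Implements U⁻¹ Γ⁻¹ := by
  intro x
  obtain ⟨z, hz⟩ := hU ((Γ⁻¹).1 *ᵥ x)
  have hz0 := Implements.coeff_ne_zero hz
  rw [(sp_inv_mulVec_eq_iff Γ x _).mp rfl |>.symm] at hz
  refine ⟨z⁻¹, ?_⟩
  have h : (weylU n x : Op n) * U = z⁻¹ • ((U : Op n) * weylU n ((Γ⁻¹).1 *ᵥ x)) := by
    rw [hz, smul_smul, inv_mul_cancel₀ hz0, one_smul]
  calc ((U⁻¹ : UnitaryOp n) : Op n) * weylU n x
      = ((U⁻¹ : UnitaryOp n) : Op n) * ((weylU n x : Op n) * U) * (U⁻¹ : UnitaryOp n) := by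
        rw [mul_assoc, mul_assoc, unitary_mul_inv, mul_one]
    _ = z⁻¹ • ((((U⁻¹ : UnitaryOp n) : Op n) * U) *
          ((weylU n ((Γ⁻¹).1 *ᵥ x) : Op n) * (U⁻¹ : UnitaryOp n))) := by
        rw [h, Matrix.mul_smul, Matrix.smul_mul]
        simp only [mul_assoc]
    _ = _ := by rw [unitary_inv_mul, one_mul]

/-- Weyl operators square to `±1`, so moving `W_x` past `U` twice gives `z² = ±1`. Hence conjugation
only introduces powers of `i`, which the Pauli group contains. -/
theorem Implements.coeff_pow_four {n : ℕ} {U : UnitaryOp n} {x y : Vec n} {z : ℂ}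
    (h : (U : Op n) * weylU n x = z • ((weylU n y : Op n) * U)) : z ^ 4 = 1 := by
  have h1 : (U : Op n) * (weylU n x * weylU n x) =
      z ^ 2 • (((weylU n y : Op n) * weylU n y) * U) := by
    rw [← mul_assoc, h, Matrix.smul_mul, mul_assoc, h, Matrix.mul_smul, smul_smul, ← sq, mul_assoc]
  rw [weylU_mul_self, weylU_mul_self, Matrix.mul_smul, Matrix.smul_mul, mul_one, one_mul,
    smul_smul] at h1
  have h2 := smul_left_injective ℂ (unitary_ne_zero U) h1
  have h3 := congrArg (· ^ 2) h2
  simp only [mul_pow, sgn_sq, mul_one] at h3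
  rw [h3]
  ring

/-- Sharpens `pauliOne_eq` by controlling the phase: membership in the Pauli group itself, not only
modulo phases, is needed for the normalizer. -/
theorem pauliOne_eq_pow_four (P : Matrix.unitaryGroup (Fin 2) ℂ) (hP : P ∈ pauliOne) :
    ∃ (c : ℂ) (p q : ZMod 2), c ^ 4 = 1 ∧ (P : Matrix (Fin 2) (Fin 2) ℂ) = c • weylOne p q := by
  have hs : ∀ a, sgn a ^ 4 = 1 := fun a => by
    rw [show 4 = 2 * 2 from rfl, pow_mul, sgn_sq, one_pow]
  induction hP using Subgroup.closure_induction with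
  | mem P h =>
    rcases h with rfl | rfl | rfl
    · exact ⟨1, 0, 1, by simp, by simp [weylOne, pauliX, ZMod.val_one]⟩
    · exact ⟨1, 1, 0, by simp, by simp [weylOne, pauliZ, ZMod.val_one]⟩
    · exact ⟨Complex.I, 0, 0, Complex.I_pow_four, by simp [weylOne, scalarI]⟩
  | one => exact ⟨1, 0, 0, by simp, by simp [weylOne]⟩
  | mul P Q _ _ ihP ihQ =>
    obtain ⟨c, p, q, hc, h⟩ := ihP
    obtain ⟨d, p', q', hd, h'⟩ := ihQ
    refine ⟨d * c * sgn (q * p'), p + p', q + q', ?_, ?_⟩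
    · rw [mul_pow, mul_pow, hc, hd, hs, one_mul, one_mul]
    · rw [Matrix.UnitaryGroup.mul_val, h, h', Matrix.mul_smul, Matrix.smul_mul, weylOne_mul,
        smul_smul, smul_smul]
  | inv P _ ih =>
    obtain ⟨c, p, q, hc, h⟩ := ih
    refine ⟨star c * sgn (q * p), p, q, ?_, ?_⟩
    · rw [mul_pow, ← star_pow, hc, hs, star_one, one_mul]
    rw [Matrix.UnitaryGroup.inv_val, h]
    rcases zmod_two_cases p with rfl | rfl <;> rcases zmod_two_cases q with rfl | rfl <;>
      ext i j <;> fin_cases i <;> fin_cases j <;>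
      simp [weylOne, matX, matZ, ZMod.val_one, sgn_zero, sgn_one, Matrix.star_apply]

theorem pauliGroup_eq_smul_weylU {n : ℕ} {P : UnitaryOp n} (hP : P ∈ pauliGroup n) :
    ∃ (c : ℂ) (x : Vec n), c ^ 4 = 1 ∧ (P : Op n) = c • (weylU n x : Op n) := by
  obtain ⟨A, hA, rfl⟩ := hP
  have hA' : ∀ i, A i ∈ pauliOne := fun i => (Subgroup.mem_pi _).mp hA i trivial
  choose z p q hz h using fun i => pauliOne_eq_pow_four (A i) (hA' i)
  refine ⟨∏ i, z i, Sum.elim p q, ?_, ?_⟩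
  · rw [← Finset.prod_pow]
    exact Finset.prod_eq_one fun i _ => hz i
  · simp only [coe_tensorU, h, tensorMat_smul]
    rfl

/-- The phase is some `i^k`, and it is placed on the first tensor factor; this is why at least one
qubit is required. -/
theorem mem_pauliGroup_of_eq_smul_weylU {m : ℕ} {P : UnitaryOp (m + 1)} {c : ℂ}
    {x : Vec (m + 1)} (hc : c ^ 4 = 1) (h : (P : Op (m + 1)) = c • (weylU (m + 1) x : Op (m + 1))) :
    P ∈ pauliGroup (m + 1) := by
  obtain ⟨k, -, rfl⟩ := Complex.isPrimitiveRoot_I.eq_pow_of_pow_eq_one hc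
  have hmem : tensorU (m + 1) (Pi.mulSingle 0 scalarI) ∈ pauliGroup (m + 1) := by
    refine Subgroup.mem_map_of_mem _ ((Subgroup.mem_pi _).mpr fun i _ => ?_)
    by_cases hi : i = 0
    · subst hi
      rw [Pi.mulSingle_eq_same]
      exact Subgroup.subset_closure (by simp)
    · rw [Pi.mulSingle_eq_of_ne hi]
      exact one_mem _
  have hval : (tensorU (m + 1) (Pi.mulSingle 0 scalarI) : Op (m + 1)) = Complex.I • 1 := by
    rw [coe_tensorU, ← onQubit_one (m + 1) 0, ← onQubit_smul, onQubit]
    congr 1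
    funext i
    by_cases hi : i = 0
    · subst hi
      simp [scalarI]
    · simp [hi]
  have hP : P = tensorU (m + 1) (Pi.mulSingle 0 scalarI) ^ k * weylU (m + 1) x := by
    apply Subtype.ext
    rw [Matrix.UnitaryGroup.mul_val, SubmonoidClass.coe_pow, hval, h, smul_pow, one_pow,
      Matrix.smul_mul, one_mul]
  rw [hP]
  exact mul_mem (pow_mem hmem k) (weylU_mem_pauliGroup _ x)

theorem Implements.conj_mem_pauliGroup {n : ℕ} {U : UnitaryOp n} {Γ : Sp n}
    (hU : Implements U Γ) {P : UnitaryOp n} (hP : P ∈ pauliGroup n) :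
    U * P * U⁻¹ ∈ pauliGroup n := by
  cases n with
  | zero =>
    -- With no qubits there is no factor to absorb a phase, but the matrices are 1-by-1 and commute.
    have h : U * P = P * U := Subtype.ext <| by
      rw [Matrix.UnitaryGroup.mul_val, Matrix.UnitaryGroup.mul_val]
      ext x y
      rw [Matrix.mul_apply, Matrix.mul_apply]
      exact Finset.sum_congr rfl fun z _ => by
        rw [Subsingleton.elim x z, Subsingleton.elim y z, mul_comm]
    rwa [h, mul_inv_cancel_right]
  | succ m =>
    obtain ⟨c, x, hc, h⟩ := pauliGroup_eq_smul_weylU hP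
    obtain ⟨z, hz⟩ := hU x
    refine mem_pauliGroup_of_eq_smul_weylU (c := c * z) (x := Γ.1 *ᵥ x) ?_ ?_
    · rw [mul_pow, hc, Implements.coeff_pow_four hz, one_mul]
    · rw [Matrix.UnitaryGroup.mul_val, Matrix.UnitaryGroup.mul_val, h, Matrix.mul_smul, hz,
        smul_smul, Matrix.smul_mul, mul_assoc, unitary_mul_inv, mul_one]

theorem Implements.mem_clifford {n : ℕ} {U : UnitaryOp n} {Γ : Sp n} (hU : Implements U Γ) :
    U ∈ clifford n := by
  rw [clifford, Subgroup.mem_normalizer_iff]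
  refine fun P => ⟨fun hP => hU.conj_mem_pauliGroup hP, fun hP => ?_⟩
  have h := hU.inv.conj_mem_pauliGroup hP
  rwa [inv_inv, mul_assoc, mul_assoc, mul_assoc, inv_mul_cancel_left, inv_mul_cancel,
    mul_one] at h

theorem cliffordAction_cls_eq_iff {n : ℕ} (U : ↥(clifford n)) (Γ : Sp n) :
    cliffordAction n (cls n U) = Γ ↔ Implements (U : UnitaryOp n) Γ := by
  constructor
  · rintro rfl x
    exact (conj_weyl_iff n U x _).mp (cliffordAction_spec n (cls n U) x)
  · intro h
    apply symplectic_ext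
    intro x
    apply weyl_injective n
    rw [← cliffordAction_spec, conj_weyl_iff]
    exact h x

theorem implements_weylU {n : ℕ} (y : Vec n) : Implements (weylU n y) 1 := fun x =>
  ⟨_, by rw [sp_one_mulVec]; exact weylU_comm n y x⟩

/-- Put `K = c W_v`; the condition on `c` says `K² = -1`. If `W_x` commutes with `K`, it commutes
with `1 + K`. If it anticommutes, then `(1 + K) W_x = K W_x (1 + K)`, and `K W_x` is a multiple of
`W_{x+v}`. -/
theorem implements_transvection {n : ℕ} (v : Vec n) (c : ℂ)
    (hc : c ^ 2 * sgn (∑ i, v (Sum.inr i) * v (Sum.inl i)) = -1) (U : UnitaryOp n)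
    (hU : (U : Op n) = (1 / (Real.sqrt 2 : ℂ)) • (1 + c • (weylU n v : Op n))) :
    Implements U (transvection n v) := by
  intro x
  rcases zmod_two_cases (form n x v) with h | h
  · refine ⟨1, ?_⟩
    rw [transvection_apply_of_form_eq_zero h, one_smul, hU, Matrix.smul_mul, Matrix.mul_smul,
      add_mul, mul_add, one_mul, mul_one, Matrix.smul_mul, Matrix.mul_smul, weylU_comm n x v, h,
      sgn_zero, one_smul]
  · refine ⟨c * sgn (∑ i, v (Sum.inr i) * x (Sum.inl i)), ?_⟩
    have h1 : (weylU n x : Op n) * weylU n v = -((weylU n v : Op n) * weylU n x) := by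
      rw [weylU_comm, h, sgn_one, neg_smul, one_smul]
    have h2 : (c * sgn (∑ i, v (Sum.inr i) * x (Sum.inl i))) • (weylU n (x + v) : Op n) =
        c • ((weylU n v : Op n) * weylU n x) := by
      rw [weylU_mul, smul_smul, add_comm]
    rw [transvection_apply_of_form_eq_one h, ← Matrix.smul_mul, h2, hU, Matrix.smul_mul,
      Matrix.mul_smul, Matrix.smul_mul, mul_add, mul_one, add_mul, one_mul, Matrix.mul_smul,
      Matrix.smul_mul, mul_assoc, h1, mul_neg, ← mul_assoc, weylU_mul_self, Matrix.smul_mul,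
      one_mul, smul_add, smul_add, smul_neg, smul_neg, smul_smul c, smul_smul (c * c), ← sq c, hc,
      neg_smul, one_smul, neg_neg, smul_add, add_comm]

/-- The adjoint is the inverse, and `W_v² = ±1` makes the inverse `±W_v` with the same sign. -/
theorem star_weylU {n : ℕ} (v : Vec n) : star (weylU n v : Op n) =
    sgn (∑ i, v (Sum.inr i) * v (Sum.inl i)) • (weylU n v : Op n) := by
  have h : star (weylU n v : Op n) * weylU n v = 1 :=
    Matrix.mem_unitaryGroup_iff'.mp (weylU n v).2
  have h2 : star (weylU n v : Op n) * ((weylU n v : Op n) * weylU n v) = weylU n v := by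
    rw [← mul_assoc, h, one_mul]
  rw [weylU_mul_self, Matrix.mul_smul, mul_one] at h2
  rw [← h2, smul_smul, sgn_mul_self, one_smul, h2]

/-- With `K = c W_v`, the two conditions on `c` give `K² = -1` and `K* = -K`, so `(1 + K)(1 - K) / 2
= 1`. -/
theorem one_add_smul_weylU_mem_unitaryGroup {n : ℕ} (v : Vec n) (c : ℂ)
    (hc : c ^ 2 * sgn (∑ i, v (Sum.inr i) * v (Sum.inl i)) = -1) (hn : star c * c = 1) :
    (1 / (Real.sqrt 2 : ℂ)) • (1 + c • (weylU n v : Op n)) ∈ Matrix.unitaryGroup _ ℂ := by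
  have hr : (Real.sqrt 2 : ℂ) * (Real.sqrt 2 : ℂ) = 2 := by
    rw [← Complex.ofReal_mul, Real.mul_self_sqrt zero_le_two]
    simp
  have hr' : (1 / (Real.sqrt 2 : ℂ)) * star (1 / (Real.sqrt 2 : ℂ)) = 1 / 2 := by
    simp only [one_div, star_inv₀, Complex.star_def, Complex.conj_ofReal]
    rw [← mul_inv, hr]
  have hs := sgn_mul_self (∑ i, v (Sum.inr i) * v (Sum.inl i))
  have hcs : star c * sgn (∑ i, v (Sum.inr i) * v (Sum.inl i)) = -c := by
    generalize sgn (∑ i, v (Sum.inr i) * v (Sum.inl i)) = s at hc hs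
    linear_combination s * star c * hc - c * s ^ 2 * hn - c * hs
  rw [Matrix.mem_unitaryGroup_iff, star_smul, star_add, star_one, star_smul, star_weylU, smul_smul,
    hcs, Matrix.smul_mul, Matrix.mul_smul, smul_smul, hr', mul_add, add_mul, add_mul,
    Matrix.smul_mul, Matrix.mul_smul, Matrix.smul_mul, Matrix.mul_smul, weylU_mul_self]
  simp only [one_mul, mul_one, smul_smul]
  have : c * (-c * sgn (∑ i, v (Sum.inr i) * v (Sum.inl i))) = 1 := by linear_combination -hc
  rw [this, neg_smul, one_smul]
  rw [show (1 + c • (weylU n v : Op n) + (-(c • (weylU n v : Op n)) + 1)) = (2 : ℂ) • 1 by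
    rw [two_smul]; abel, smul_smul]
  norm_num

theorem exists_implements_transvection {n : ℕ} (v : Vec n) :
    ∃ U : UnitaryOp n, Implements U (transvection n v) := by
  obtain ⟨c, hc, hn⟩ : ∃ c : ℂ, c ^ 2 * sgn (∑ i, v (Sum.inr i) * v (Sum.inl i)) = -1 ∧
      star c * c = 1 := by
    -- The sum is the exponent in `W_v² = ±1`: take `c = i` when `W_v² = 1` and `c = 1` when `W_v² =
    -- -1`.
    rcases zmod_two_cases (∑ i, v (Sum.inr i) * v (Sum.inl i)) with h | h
    · exact ⟨Complex.I, by simp [h, sgn_zero], by simp⟩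
    · exact ⟨1, by simp [h, sgn_one], by simp⟩
  exact ⟨⟨_, one_add_smul_weylU_mem_unitaryGroup v c hc hn⟩,
    implements_transvection v c hc _ rfl⟩

theorem transvectionGroup_le_range (n : ℕ) : transvectionGroup n ≤ (cliffordAction n).range := by
  rw [transvectionGroup, Subgroup.closure_le]
  rintro _ ⟨v, rfl⟩
  obtain ⟨U, hU⟩ := exists_implements_transvection v
  exact ⟨cls n ⟨U, hU.mem_clifford⟩, (cliffordAction_cls_eq_iff _ _).mpr hU⟩

/-! ### The kernel of the action on `ℤ₂^{2n}` -/

theorem weylU_single_inl (n : ℕ) (j : Fin n) :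
    (weylU n (Pi.single (Sum.inl j) 1) : Op n) = onQubit n j matZ := by
  rw [coe_weylU, onQubit]
  congr 1
  funext i
  by_cases hi : i = j
  · subst hi
    simp [weylOne, ZMod.val_one]
  · simp [weylOne, hi]

theorem weylU_single_inr (n : ℕ) (j : Fin n) :
    (weylU n (Pi.single (Sum.inr j) 1) : Op n) = onQubit n j matX := by
  rw [coe_weylU, onQubit]
  congr 1
  funext i
  by_cases hi : i = j
  · subst hi
    simp [weylOne, ZMod.val_one]
  · simp [weylOne, hi]

theorem exists_weylU_eq_mapOp (n : ℕ) (q : Fin n → Fin 2) :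
    ∃ v, (weylU n v : Op n) = mapOp n fun y => y + q := by
  have hX : ∀ a b c : Fin 2,
      weylOne 0 (if c = 0 then 0 else 1) a b = if a = b + c then 1 else 0 := by
    intro a b c
    fin_cases a <;> fin_cases b <;> fin_cases c <;> simp [weylOne, matX, ZMod.val_one]
  refine ⟨Sum.elim (fun _ => 0) fun i => if q i = 0 then 0 else 1, ?_⟩
  ext x y
  rw [coe_weylU, tensorMat_apply, mapOp, Matrix.of_apply]
  simp only [Sum.elim_inl, Sum.elim_inr, hX, funext_iff, Pi.add_apply]
  rw [Finset.prod_ite_zero]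
  simp

/-- An operator commuting with all Weyl operators is scalar. -/
theorem eq_smul_one_of_forall_commute {n : ℕ} (B : Op n)
    (h : ∀ x, B * weylU n x = (weylU n x : Op n) * B) : B = B 0 0 • 1 := by
  -- Commuting with `Z_j` kills every entry between strings differing at bit `j`.
  have hoff : ∀ x y, x ≠ y → B x y = 0 := by
    intro x y hxy
    obtain ⟨j, hj⟩ := Function.ne_iff.mp hxy
    have hz := congrFun (congrFun (h (Pi.single (Sum.inl j) 1)) x) y
    rw [weylU_single_inl, onQubit_matZ, Matrix.mul_diagonal, Matrix.diagonal_mul] at hz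
    have : ∀ a : Fin 2, a = 0 ∨ a = 1 := by decide
    rcases this (x j) with hx | hx <;> rcases this (y j) with hy | hy <;>
      simp [hx, hy] at hz hj
    · have h2 : (2 : ℂ) * B x y = 0 := by linear_combination -hz
      simpa using h2
    · have h2 : (2 : ℂ) * B x y = 0 := by linear_combination hz
      simpa using h2
  -- Products of `X`'s translate the string `0` to any `x`, so all diagonal entries agree.
  have hdiag : ∀ x, B x x = B 0 0 := by
    intro x
    obtain ⟨v, hv⟩ := exists_weylU_eq_mapOp n x
    have hx := congrFun (congrFun (h v) x) 0
    rw [hv] at hx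
    simpa [mapOp, Matrix.mul_apply] using hx
  ext x y
  rw [Matrix.smul_apply, Matrix.one_apply]
  split_ifs with hxy
  · rw [← hxy, hdiag, smul_eq_mul, mul_one]
  · rw [hoff x y hxy, smul_zero]

theorem exists_eq_form (n : ℕ) (a : Vec n → ZMod 2) (ha : ∀ x y, a (x + y) = a x + a y) :
    ∃ y, ∀ x, a x = form n x y := by
  let L : Vec n →ₗ[ZMod 2] ZMod 2 := AddMonoidHom.toZModLinearMap 2 (AddMonoidHom.mk' a ha)
  -- The form pairs each half of the coordinates with the other, so the values of `a` on basis
  -- vectors are entered with the halves exchanged.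
  refine ⟨Sum.elim (fun i => a (Pi.single (Sum.inr i) 1)) fun i => a (Pi.single (Sum.inl i) 1),
    fun x => ?_⟩
  have h := LinearMap.pi_apply_eq_sum_univ L x
  have hs : ∀ i : Fin n ⊕ Fin n, (fun j => if i = j then (1 : ZMod 2) else 0) = Pi.single i 1 := by
    intro i
    funext j
    simp [Pi.single_apply, eq_comm]
  simp only [hs, Fintype.sum_sum_type, smul_eq_mul] at h
  rw [form, ← show L x = a x from rfl, h, ← Finset.sum_add_distrib]
  refine Finset.sum_congr rfl fun i _ => ?_
  rw [CharTwo.sub_eq_add]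
  rfl

theorem exists_eq_sgn {z : ℂ} (h : z ^ 2 = 1) : ∃ a, z = sgn a := by
  rcases eq_or_eq_neg_of_sq_eq_sq z 1 (by rw [h, one_pow]) with h | h
  · exact ⟨0, by rw [h, sgn_zero]⟩
  · exact ⟨1, by rw [h, sgn_one]⟩

/-- The kernel of the action of the projective Clifford group is the projective Pauli group. -/
theorem mem_projPauli_of_cliffordAction_eq_one {n : ℕ} (c : ProjClifford n)
    (hc : cliffordAction n c = 1) : c ∈ projPauli n := by
  obtain ⟨U, rfl⟩ := QuotientGroup.mk'_surjective _ c
  have hU := (cliffordAction_cls_eq_iff U 1).mp hc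
  simp only [Implements, sp_one_mulVec] at hU
  choose z hz using hU
  have hWU : ∀ x, (weylU n x : Op n) * (U : UnitaryOp n) ≠ 0 := fun x => by
    rw [← Matrix.UnitaryGroup.mul_val]
    exact unitary_ne_zero _
  -- The phases form a character of an elementary abelian 2-group, hence equal `(-1)^[x, y]` for one
  -- `y`. Then `W_y⁻¹ U` commutes with all Weyl operators and is scalar.
  have hmul : ∀ x y, z (x + y) = z x * z y := by
    intro x y
    have h1 : ((U : UnitaryOp n) : Op n) * ((weylU n x : Op n) * weylU n y) =
        (z x * z y) • (((weylU n x : Op n) * weylU n y) * (U : UnitaryOp n)) := by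
      rw [← mul_assoc, hz, Matrix.smul_mul, mul_assoc, hz, Matrix.mul_smul, smul_smul, mul_assoc]
    rw [weylU_mul, Matrix.mul_smul, hz, Matrix.smul_mul, smul_comm (z x * z y)] at h1
    exact smul_left_injective ℂ (hWU _) (smul_right_injective _ (sgn_ne_zero _) h1)
  have hz0 : z 0 = 1 := by
    have h := hmul 0 0
    rw [add_zero] at h
    exact (left_eq_mul₀ (Implements.coeff_ne_zero (hz 0))).mp h
  choose a ha using fun x => exists_eq_sgn (z := z x)
    (by rw [sq, ← hmul, vec_add_self, hz0])
  obtain ⟨y, hy⟩ := exists_eq_form n a fun x y => sgn_injective (by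
    rw [sgn_add, ← ha, ← ha, ← ha, hmul])
  have hcomm : ∀ x, ((((weylU n y)⁻¹ : UnitaryOp n) : Op n) * (U : UnitaryOp n)) * weylU n x =
      (weylU n x : Op n) * ((((weylU n y)⁻¹ : UnitaryOp n) : Op n) * (U : UnitaryOp n)) := by
    intro x
    have h1 : (((weylU n y)⁻¹ : UnitaryOp n) : Op n) * weylU n x =
        sgn (form n x y) • ((weylU n x : Op n) * ((weylU n y)⁻¹ : UnitaryOp n)) := by
      calc (((weylU n y)⁻¹ : UnitaryOp n) : Op n) * weylU n x
          = ((weylU n y)⁻¹ : UnitaryOp n) * ((weylU n x : Op n) * weylU n y) *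
              ((weylU n y)⁻¹ : UnitaryOp n) := by
            rw [mul_assoc, mul_assoc, unitary_mul_inv, mul_one]
        _ = sgn (form n x y) • (((((weylU n y)⁻¹ : UnitaryOp n) : Op n) * weylU n y) *
              ((weylU n x : Op n) * ((weylU n y)⁻¹ : UnitaryOp n))) := by
            rw [weylU_comm, Matrix.mul_smul, Matrix.smul_mul]
            simp only [mul_assoc]
        _ = _ := by rw [unitary_inv_mul, one_mul]
    rw [mul_assoc, hz, ha, hy, Matrix.mul_smul, ← mul_assoc, h1, Matrix.smul_mul, smul_smul,
      sgn_mul_self, one_smul, mul_assoc]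
  have hscal := eq_smul_one_of_forall_commute _ hcomm
  have hcls : weyl n y = cls n U := by
    rw [weyl, cls_eq_iff]
    refine ⟨((((weylU n y)⁻¹ : UnitaryOp n) : Op n) * (U : UnitaryOp n)) 0 0, ?_⟩
    calc ((U : UnitaryOp n) : Op n)
        = (weylU n y : Op n) *
          ((((weylU n y)⁻¹ : UnitaryOp n) : Op n) * (U : UnitaryOp n)) := by
          rw [← mul_assoc, unitary_mul_inv, one_mul]
      _ = (weylU n y : Op n) * (((((weylU n y)⁻¹ : UnitaryOp n) : Op n) *
          (U : UnitaryOp n)) 0 0 • 1) := congrArg _ hscal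
      _ = _ := by rw [Matrix.mul_smul, mul_one]
  rw [show (QuotientGroup.mk' ((phases n).subgroupOf (clifford n))) U = weyl n y from hcls.symm]
  exact weyl_mem_projPauli n y

theorem inertiaAction_injective (m : ℕ) : Function.Injective (inertiaAction m) := by
  rw [injective_iff_map_eq_one]
  intro c hc
  obtain ⟨c, rfl⟩ := QuotientGroup.mk_surjective c
  rw [QuotientGroup.eq_one_iff, Subgroup.mem_subgroupOf]
  exact mem_projPauli_of_cliffordAction_eq_one _ hc

/-! ### Splitting off the first qubit -/

/-- The vector with first-qubit components `a`, `b` and the other components given by `w`. -/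
def consVec {m : ℕ} (a b : ZMod 2) (w : Vec m) : Vec (m + 1) :=
  Sum.elim (Fin.cons a fun i => w (Sum.inl i)) (Fin.cons b fun i => w (Sum.inr i))

theorem exists_eq_consVec {m : ℕ} (x : Vec (m + 1)) : ∃ a b w, x = consVec a b w := by
  refine ⟨x (Sum.inl 0), x (Sum.inr 0), fun i => x (Sum.map Fin.succ Fin.succ i), ?_⟩
  funext i
  rcases i with i | i <;> refine Fin.cases ?_ (fun i => ?_) i <;> simp [consVec]

theorem consVec_add {m : ℕ} (a b a' b' : ZMod 2) (w w' : Vec m) :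
    consVec a b w + consVec a' b' w' = consVec (a + a') (b + b') (w + w') := by
  funext i
  rcases i with i | i <;> refine Fin.cases ?_ (fun i => ?_) i <;> simp [consVec]

theorem consVec_inj {m : ℕ} {a b a' b' : ZMod 2} {w w' : Vec m} :
    consVec a b w = consVec a' b' w' ↔ a = a' ∧ b = b' ∧ w = w' := by
  refine ⟨fun h => ⟨?_, ?_, ?_⟩, by rintro ⟨rfl, rfl, rfl⟩; rfl⟩
  · simpa [consVec] using congrFun h (Sum.inl 0)
  · simpa [consVec] using congrFun h (Sum.inr 0)
  · funext i
    rcases i with i | i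
    · simpa [consVec] using congrFun h (Sum.inl i.succ)
    · simpa [consVec] using congrFun h (Sum.inr i.succ)

theorem form_consVec {m : ℕ} (a b a' b' : ZMod 2) (w w' : Vec m) :
    form (m + 1) (consVec a b w) (consVec a' b' w') = a * b' - b * a' + form m w w' := by
  simp only [form, consVec, Fin.sum_univ_succ, Sum.elim_inl, Sum.elim_inr, Fin.cons_zero,
    Fin.cons_succ]

theorem single_inr_succ {m : ℕ} (i : Fin m) : (Pi.single (Sum.inr i.succ) 1 : Vec (m + 1)) =
    consVec 0 0 (Pi.single (Sum.inr i) 1) := by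
  funext j
  rcases j with j | j <;> refine Fin.cases ?_ (fun j => ?_) j <;> simp [consVec, Pi.single_apply]

theorem vecY_eq (m : ℕ) : vecY m = consVec 1 1 0 := by
  funext i
  rcases i with i | i <;> refine Fin.cases ?_ (fun i => ?_) i <;> simp [consVec, vecY]

/-- A symplectic matrix fixing the two basis vectors of the first qubit comes from the other
qubits. -/
theorem exists_sp_of_fix {m : ℕ} (Γ : Sp (m + 1)) (hz : Γ.1 *ᵥ consVec 1 0 0 = consVec 1 0 0)
    (hx : Γ.1 *ᵥ consVec 0 1 0 = consVec 0 1 0) :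
    ∃ Δ : Sp m, ∀ a b w, Γ.1 *ᵥ consVec a b w = consVec a b (Δ.1 *ᵥ w) := by
  -- Vectors of the other qubits are those orthogonal to the two fixed basis vectors, so `Γ`
  -- preserves them.
  have hw : ∀ w : Vec m, ∃ w', Γ.1 *ᵥ consVec 0 0 w = consVec 0 0 w' := by
    intro w
    obtain ⟨a, b, w', h⟩ := exists_eq_consVec (Γ.1 *ᵥ consVec 0 0 w)
    have h1 := form_symplectic _ Γ (consVec 0 0 w) (consVec 1 0 0)
    have h2 := form_symplectic _ Γ (consVec 0 0 w) (consVec 0 1 0)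
    rw [h, hz, form_consVec, form_consVec, form_comm m w', form_comm m w, form_zero_left,
      form_zero_left] at h1
    rw [h, hx, form_consVec, form_consVec, form_comm m w', form_comm m w, form_zero_left,
      form_zero_left] at h2
    simp only [mul_zero, mul_one, zero_sub, sub_zero, add_zero, neg_eq_zero] at h1 h2
    exact ⟨w', by rw [h, h1, h2]⟩
  choose g hg using hw
  obtain ⟨Δ, hΔ⟩ := exists_sp_of_isometry m g (fun x y => by
      have h : consVec 0 0 (g (x + y)) = consVec 0 0 (g x + g y) := by
        rw [← hg, ← add_zero (0 : ZMod 2), ← consVec_add, ← consVec_add, Matrix.mulVec_add, hg, hg]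
      exact (consVec_inj.mp h).2.2) fun x y => by
    have h := form_symplectic _ Γ (consVec 0 0 x) (consVec 0 0 y)
    rw [hg, hg, form_consVec, form_consVec] at h
    simpa using h
  refine ⟨Δ, fun a b w => ?_⟩
  have hsplit : ∀ w : Vec m, consVec a b w =
      a • consVec 1 0 0 + b • consVec 0 1 0 + consVec 0 0 w := by
    intro w
    funext i
    rcases i with i | i <;> refine Fin.cases ?_ (fun i => ?_) i <;> simp [consVec]
  rw [hsplit, hsplit, Matrix.mulVec_add, Matrix.mulVec_add, Matrix.mulVec_smul,
    Matrix.mulVec_smul, hz, hx, hg, hΔ]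

theorem idTensor_mul (m : ℕ) (A B : Op m) : idTensor m (A * B) = idTensor m A * idTensor m B := by
  ext x y
  rw [Matrix.mul_apply, ← (Fin.consEquiv fun _ : Fin (m + 1) => Fin 2).sum_comp,
    Fintype.sum_prod_type]
  simp [idTensor, Fin.consEquiv, Matrix.one_apply, Matrix.mul_apply]

theorem idTensor_one (m : ℕ) : idTensor m 1 = 1 := by
  ext x y
  rw [← onQubit_one (m + 1) 0, onQubit_zero_apply]
  rfl

theorem idTensor_smul (m : ℕ) (c : ℂ) (A : Op m) : idTensor m (c • A) = c • idTensor m A := by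
  ext x y
  simp only [idTensor, Matrix.of_apply, Matrix.smul_apply, smul_eq_mul]
  ring

theorem star_idTensor (m : ℕ) (A : Op m) : star (idTensor m A) = idTensor m (star A) := by
  ext x y
  simp only [idTensor, Matrix.of_apply, Matrix.star_apply, star_mul', Matrix.one_apply, eq_comm]
  split_ifs <;> simp

theorem idTensor_mem_unitaryGroup (m : ℕ) (A : UnitaryOp m) :
    idTensor m A ∈ Matrix.unitaryGroup (Fin (m + 1) → Fin 2) ℂ := by
  rw [Matrix.mem_unitaryGroup_iff, star_idTensor, ← idTensor_mul,
    Matrix.mem_unitaryGroup_iff.mp A.2, idTensor_one]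

theorem weylU_consVec {m : ℕ} (a b : ZMod 2) (w : Vec m) :
    (weylU (m + 1) (consVec a b w) : Op (m + 1)) =
      onQubit (m + 1) 0 (weylOne a b) * idTensor m (weylU m w) := by
  ext x y
  rw [Matrix.mul_apply, ← (Fin.consEquiv fun _ : Fin (m + 1) => Fin 2).sum_comp,
    Fintype.sum_prod_type]
  simp only [onQubit_zero_apply, idTensor, Fin.consEquiv, Matrix.of_apply, coe_weylU,
    tensorMat_apply, Fin.prod_univ_succ, Equiv.coe_fn_mk, Fin.cons_zero, Fin.tail_cons]
  simp [Matrix.one_apply, consVec, Fin.tail]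

theorem implements_idTensor {m : ℕ} {A : UnitaryOp m} {Δ : Sp m} (hA : Implements A Δ)
    {Γ : Sp (m + 1)} (hΓ : ∀ a b w, Γ.1 *ᵥ consVec a b w = consVec a b (Δ.1 *ᵥ w)) :
    Implements (⟨idTensor m A, idTensor_mem_unitaryGroup m A⟩ : UnitaryOp (m + 1)) Γ := by
  intro x
  obtain ⟨a, b, w, rfl⟩ := exists_eq_consVec x
  obtain ⟨z, hz⟩ := hA w
  refine ⟨z, ?_⟩
  rw [hΓ, weylU_consVec, weylU_consVec, ← mul_assoc, idTensor_comm, mul_assoc, ← idTensor_mul, hz,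
    idTensor_smul, idTensor_mul, Matrix.mul_smul, mul_assoc]

/-- Every symplectic matrix is induced by a Clifford operator. -/
theorem cliffordAction_surjective (n : ℕ) : Function.Surjective (cliffordAction n) := by
  induction n with
  | zero => exact fun Γ => ⟨1, symplectic_ext 0 _ _ fun x => Subsingleton.elim _ _⟩
  | succ m ih =>
    rw [← MonoidHom.range_eq_top, eq_top_iff]
    intro Γ _
    have h1 : form (m + 1) (consVec 1 0 0) (consVec 0 1 0) = 1 := by
      simp [form_consVec, form_zero_left]
    -- Transvections return the images of the first-qubit basis vectors to their place. What remains
    -- lives on `m` qubits, where the induction hypothesis applies.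
    obtain ⟨T, hT, hTz, hTx⟩ := exists_transvectionGroup_apply_pair
      ((form_symplectic _ Γ (consVec 1 0 0) (consVec 0 1 0)).trans h1) h1
    rw [← sp_mul_mulVec] at hTz hTx
    obtain ⟨Δ, hΔ⟩ := exists_sp_of_fix (T * Γ) hTz hTx
    obtain ⟨c, hc⟩ := ih Δ
    obtain ⟨A, rfl⟩ := QuotientGroup.mk'_surjective _ c
    have hA := implements_idTensor ((cliffordAction_cls_eq_iff A Δ).mp hc) hΔ
    rw [← inv_mul_cancel_left T Γ]
    exact mul_mem (inv_mem (transvectionGroup_le_range _ hT))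
      ⟨cls _ ⟨_, hA.mem_clifford⟩, (cliffordAction_cls_eq_iff _ _).mpr hA⟩

/-! ### The action of `IN_n` -/

/-- The image of `IN_n` in the symplectic group. -/
noncomputable def inertiaImage (m : ℕ) : Subgroup (Sp (m + 1)) := (inertiaAction m).range

theorem mem_inertiaImage {m : ℕ} {U : UnitaryOp (m + 1)} {Γ : Sp (m + 1)}
    (hU : (U : Op (m + 1)) ∈ inertiaGenerators m) (h : Implements U Γ) : Γ ∈ inertiaImage m := by
  have hIN : cls _ ⟨U, h.mem_clifford⟩ ∈ IN m := Subgroup.subset_closure ⟨_, hU, rfl⟩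
  exact ⟨QuotientGroup.mk ⟨_, hIN⟩, (cliffordAction_cls_eq_iff _ _).mpr h⟩

theorem inertiaAction_vecY (m : ℕ) (c : InertiaQuotient m) :
    (inertiaAction m c).1 *ᵥ vecY m = vecY m := by
  obtain ⟨c, rfl⟩ := QuotientGroup.mk_surjective c
  apply weyl_injective
  exact (cliffordAction_spec (m + 1) c (vecY m)).symm.trans (comm_weyl_vecY m c c.2)

theorem matH_eq : matH = (1 / (Real.sqrt 2 : ℂ)) • (matX + matZ) := by
  ext i j
  fin_cases i <;> fin_cases j <;> simp [matH, matX, matZ]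

theorem onQubit_add (n : ℕ) (j : Fin n) (A B : Matrix (Fin 2) (Fin 2) ℂ) :
    onQubit n j (A + B) = onQubit n j A + onQubit n j B := by
  ext x y
  simp only [onQubit_apply, Matrix.add_apply]
  split_ifs <;> simp

/-- Since `(ZX)² = -1`, the factor `(1 + ZX)/√2` is the operator of the transvection at `ZX`; thus
`H` is that operator up to a Pauli factor. -/
theorem matH_eq_mul : matH = (1 / (Real.sqrt 2 : ℂ)) • (1 + matZ * matX) * matX := by
  rw [matH_eq, Matrix.smul_mul, add_mul, one_mul, mul_assoc, matX_mul_matX, mul_one]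

theorem matZ_mul_matH : matZ * matH = (1 / (Real.sqrt 2 : ℂ)) • (1 + matZ * matX) := by
  have hZ : matZ * matZ = 1 := by
    ext i j
    fin_cases i <;> fin_cases j <;> simp [matZ, Matrix.mul_apply, Fin.sum_univ_two]
  rw [matH_eq, Matrix.mul_smul, mul_add, hZ, add_comm]

/-- The condition on `v` says `W_v² = -1`, which allows `c = 1`. The extra factor `W_x` acts
trivially on vectors and absorbs the Pauli factors in `H₁` and `M`. -/
theorem exists_implements_of_eq_mul {n : ℕ} (v x : Vec n)
    (hv : ∑ i, v (Sum.inr i) * v (Sum.inl i) = 1) :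
    ∃ U : UnitaryOp n, Implements U (transvection n v) ∧ (U : Op n) =
      (1 / (Real.sqrt 2 : ℂ)) • (1 + (weylU n v : Op n)) * weylU n x := by
  have hc : (1 : ℂ) ^ 2 * sgn (∑ i, v (Sum.inr i) * v (Sum.inl i)) = -1 := by simp [hv, sgn_one]
  have hU := one_add_smul_weylU_mem_unitaryGroup v 1 hc (by simp)
  refine ⟨⟨_, hU⟩ * weylU n x, ?_, ?_⟩
  · simpa using (implements_transvection v 1 hc ⟨_, hU⟩ rfl).mul (implements_weylU x)
  · rw [Matrix.UnitaryGroup.mul_val]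
    simp only [one_smul]

theorem transvection_vecY_mem (m : ℕ) : transvection (m + 1) (vecY m) ∈ inertiaImage m := by
  obtain ⟨U, hU, h⟩ := exists_implements_of_eq_mul (vecY m) (Pi.single (Sum.inr 0) 1)
    (by simp [vecY_eq, consVec, Fin.sum_univ_succ])
  refine mem_inertiaImage (Or.inr (Or.inl ?_)) hU
  rw [h, coe_weylU_vecY, weylU_single_inr, ← onQubit_one (m + 1) 0, ← onQubit_add,
    ← onQubit_smul, ← onQubit_mul, ← matH_eq_mul]

theorem gateCX_mul_self (n : ℕ) {c t : Fin n} (h : c ≠ t) : gateCX n c t * gateCX n c t = 1 := by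
  rw [gateCX_eq, mapOp_mul]
  ext x y
  have hf : Function.update (Function.update y t (y t + y c)) t (y t + y c + y c) = y := by
    rw [Function.update_idem, add_assoc]
    have : ∀ a : Fin 2, a + a = 0 := by decide
    rw [this, add_zero, Function.update_eq_self]
  rw [Function.update_idem] at hf
  simp [mapOp, Matrix.one_apply, h, hf]

/-- Here `Z H = (1 + ZX)/√2`, and conjugation by the controlled-`X` gate turns `Z₁X₁` into `Z₁X₁X_t`
while fixing `X_t`. So `M` is, up to a Pauli factor, a transvection operator too. -/
theorem gateM_eq (m : ℕ) (t : Fin (m + 1)) (ht : t.val = 1) :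
    gateM m t = (1 / (Real.sqrt 2 : ℂ)) •
      (1 + onQubit (m + 1) 0 (matZ * matX) * onQubit (m + 1) t matX) *
        onQubit (m + 1) t matX := by
  have h0 : (0 : Fin (m + 1)) ≠ t := by
    rintro rfl
    simp at ht
  have hCX : gateCX (m + 1) 0 t * onQubit (m + 1) 0 (matZ * matX) =
      onQubit (m + 1) 0 (matZ * matX) * onQubit (m + 1) t matX * gateCX (m + 1) 0 t := by
    rw [onQubit_mul, ← mul_assoc, gateCX_matZ _ h0, mul_assoc, gateCX_matX _ h0]
    simp only [mul_assoc]
  have hXt := gateCX_matX_target (m + 1) h0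
  have hCC := gateCX_mul_self (m + 1) h0
  rw [gateM, ← onQubit_mul, matZ_mul_matH, onQubit_smul, onQubit_add, onQubit_one,
    Matrix.smul_mul, Matrix.mul_smul, Matrix.smul_mul, Matrix.smul_mul]
  congr 1
  generalize gateCX (m + 1) 0 t = C at *
  generalize onQubit (m + 1) 0 (matZ * matX) = P at *
  generalize onQubit (m + 1) t matX = T at *
  calc C * ((1 + P) * T) * C = (C + C * P) * (T * C) := by noncomm_ring
    _ = (1 + P * T) * (C * C) * T := by rw [hCX, ← hXt]; noncomm_ring
    _ = (1 + P * T) * T := by rw [hCC, mul_one]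

theorem transvection_vecY_add_mem (m : ℕ) (t : Fin (m + 1)) (ht : t.val = 1) :
    transvection (m + 1) (vecY m + Pi.single (Sum.inr t) 1) ∈ inertiaImage m := by
  have h0 : t ≠ 0 := by
    rintro rfl
    simp at ht
  have hsum : ∑ i, vecY m (Sum.inr i) * (Pi.single (Sum.inr t) 1 : Vec (m + 1)) (Sum.inl i) = 0 :=
    Finset.sum_eq_zero fun i _ => by simp
  obtain ⟨U, hU, h⟩ := exists_implements_of_eq_mul (vecY m + Pi.single (Sum.inr t) 1)
    (Pi.single (Sum.inr t) 1)
    (by simp [vecY_eq, consVec, Fin.sum_univ_succ, h0.symm])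
  refine mem_inertiaImage (Or.inl ⟨t, ht, ?_⟩) hU
  have hw := weylU_mul (m + 1) (vecY m) (Pi.single (Sum.inr t) 1)
  rw [hsum, sgn_zero, one_smul, coe_weylU_vecY, weylU_single_inr] at hw
  rw [h, weylU_single_inr, ← hw, gateM_eq m t ht]

theorem mem_inertiaImage_of_consVec {m : ℕ} {Γ : Sp (m + 1)} {Δ : Sp m}
    (hΓ : ∀ a b w, Γ.1 *ᵥ consVec a b w = consVec a b (Δ.1 *ᵥ w)) : Γ ∈ inertiaImage m := by
  obtain ⟨c, hc⟩ := cliffordAction_surjective m Δ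
  obtain ⟨A, rfl⟩ := QuotientGroup.mk'_surjective _ c
  exact mem_inertiaImage (Or.inr (Or.inr (Or.inr ⟨A, A.2, rfl⟩)))
    (implements_idTensor ((cliffordAction_cls_eq_iff A Δ).mp hc) hΓ)

theorem exists_sp_extend {m : ℕ} (Δ : Sp m) :
    ∃ Γ : Sp (m + 1), ∀ a b w, Γ.1 *ᵥ consVec a b w = consVec a b (Δ.1 *ᵥ w) := by
  choose a b w h using @exists_eq_consVec m
  have hc : ∀ a' b' w', a (consVec a' b' w') = a' ∧ b (consVec a' b' w') = b' ∧
      w (consVec a' b' w') = w' := fun a' b' w' => consVec_inj.mp (h (consVec a' b' w')).symm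
  obtain ⟨Γ, hΓ⟩ := exists_sp_of_isometry (m + 1)
    (fun x => consVec (a x) (b x) (Δ.1 *ᵥ w x)) (fun x y => by
      obtain ⟨a₁, b₁, w₁, rfl⟩ := exists_eq_consVec x
      obtain ⟨a₂, b₂, w₂, rfl⟩ := exists_eq_consVec y
      simp only [consVec_add, hc, Matrix.mulVec_add]) fun x y => by
    obtain ⟨a₁, b₁, w₁, rfl⟩ := exists_eq_consVec x
    obtain ⟨a₂, b₂, w₂, rfl⟩ := exists_eq_consVec y
    simp only [hc, form_consVec, form_symplectic]
  exact ⟨Γ, fun a' b' w' => by rw [hΓ]; simp only [hc]⟩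

/-- `IN_n` moves `[X₁]` to every vector whose symplectic product with `vecY` is nonzero. -/
theorem exists_inertiaImage_apply {m : ℕ} (f : Vec (m + 1)) (hf : form (m + 1) (vecY m) f = 1) :
    ∃ Γ ∈ inertiaImage m, Γ.1 *ᵥ consVec 0 1 0 = f := by
  have h2 : (1 + 1 : ZMod 2) = 0 := by decide
  -- The other-qubit part can be prescribed: the transvection of `M` carries `[X₁]` to `[Z₁] +
  -- [X₂]`, and `Sp(2m, 2)` then carries the nonzero `[X₂]` to any nonzero `w`.
  have key : ∀ w : Vec m, ∃ Γ ∈ inertiaImage m, ∃ a,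
      Γ.1 *ᵥ consVec 0 1 0 = consVec a (a + 1) w := by
    intro w
    by_cases hw : w = 0
    · exact ⟨1, one_mem _, 0, by rw [sp_one_mulVec, hw, zero_add]⟩
    cases m with
    | zero => exact absurd (Subsingleton.elim _ _) hw
    | succ k =>
      have hsingle : (Pi.single (Sum.inr 1) 1 : Vec (k + 2)) =
          consVec 0 0 (Pi.single (Sum.inr 0) 1) := single_inr_succ 0
      have hne : (Pi.single (Sum.inr 0) 1 : Vec (k + 1)) ≠ 0 := by simp
      obtain ⟨Δ, -, hΔ⟩ := exists_transvectionGroup_apply_eq hne hw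
      obtain ⟨Γ, hΓ⟩ := exists_sp_extend Δ
      refine ⟨_, mul_mem (mem_inertiaImage_of_consVec hΓ)
        (transvection_vecY_add_mem (k + 1) 1 (by simp)), 1, ?_⟩
      rw [sp_mul_mulVec, hsingle, vecY_eq, consVec_add, transvection_apply_of_form_eq_one,
        consVec_add, hΓ]
      · simp [hΔ]
      · simp [form_consVec, form_zero_left]
  obtain ⟨a, b, w, rfl⟩ := exists_eq_consVec f
  obtain ⟨Γ, hΓ, a', h⟩ := key w
  rw [vecY_eq, form_consVec, form_zero_left, add_zero, one_mul, one_mul, CharTwo.sub_eq_add] at hf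
  have hb : b = a + 1 := by
    revert a b
    decide
  subst hb
  -- Pairing to 1 with `vecY` forces `b = a + 1`, so for given `w` there are two candidates,
  -- exchanged by the transvection at `vecY`, that is, by `H₁`.
  by_cases haa : a = a'
  · exact ⟨Γ, hΓ, by rw [h, haa]⟩
  · refine ⟨_, mul_mem (transvection_vecY_mem m) hΓ, ?_⟩
    rw [sp_mul_mulVec, h, vecY_eq, transvection_apply_of_form_eq_one, consVec_add, add_zero]
    · clear h
      congr 1 <;> revert a a' <;> decide
    · rw [form_consVec, form_comm, form_zero_left, add_zero]
      clear h haa hf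
      revert a'
      decide

/-- The image of `IN_n` is the stabilizer of `vecY`. -/
theorem mem_inertiaImage_iff {m : ℕ} (Γ : Sp (m + 1)) :
    Γ ∈ inertiaImage m ↔ Γ.1 *ᵥ vecY m = vecY m := by
  constructor
  · rintro ⟨c, rfl⟩
    exact inertiaAction_vecY m c
  · intro h
    -- Since `Γ` fixes `vecY`, the image of `[X₁]` still pairs to 1 with it and is reached by some
    -- `Δ` in the image. Then `Δ⁻¹ Γ` fixes `vecY` and `[X₁]`, hence their sum `[Z₁]`.
    obtain ⟨Δ, hΔ, hx⟩ := exists_inertiaImage_apply (Γ.1 *ᵥ consVec 0 1 0) (by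
      conv_lhs => rw [← h]
      rw [form_symplectic]
      simp [vecY_eq, form_consVec, form_zero_left])
    have hΔY : Δ.1 *ᵥ vecY m = vecY m := by
      obtain ⟨c, rfl⟩ := hΔ
      exact inertiaAction_vecY m c
    have hfx : (Δ⁻¹ * Γ).1 *ᵥ consVec 0 1 0 = consVec 0 1 0 := by
      rw [sp_mul_mulVec, sp_inv_mulVec_eq_iff, hx]
    have hfY : (Δ⁻¹ * Γ).1 *ᵥ vecY m = vecY m := by
      rw [sp_mul_mulVec, sp_inv_mulVec_eq_iff, h, hΔY]
    have hz : (consVec 1 0 0 : Vec (m + 1)) = vecY m + consVec 0 1 0 := by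
      rw [vecY_eq, consVec_add, add_zero, add_zero]
      rfl
    obtain ⟨Θ, hΘ⟩ := exists_sp_of_fix (Δ⁻¹ * Γ)
      (by rw [hz, Matrix.mulVec_add, hfx, hfY]) hfx
    rw [← mul_inv_cancel_left Δ Γ]
    exact mul_mem hΔ (mem_inertiaImage_of_consVec hΘ)

/-! ### The inertia subgroup -/

theorem inertiaIncl_right (m : ℕ) (k : InertiaAffine m) :
    (inertiaIncl m k).right = inertiaAction m k.right := rfl

theorem inertiaIncl_injective (m : ℕ) : Function.Injective (inertiaIncl m) := by
  intro k l h
  have hl : (inertiaIncl m k).left = (inertiaIncl m l).left := by rw [h]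
  have hr : (inertiaIncl m k).right = (inertiaIncl m l).right := by rw [h]
  exact SemidirectProduct.ext hl (inertiaAction_injective m hr)

theorem mem_range_inertiaIncl_iff {m : ℕ} (g : AffineSp (m + 1)) :
    g ∈ (inertiaIncl m).range ↔ g.right.1 *ᵥ vecY m = vecY m := by
  rw [← mem_inertiaImage_iff]
  constructor
  · rintro ⟨k, rfl⟩
    exact ⟨k.right, rfl⟩
  · rintro ⟨c, hc⟩
    exact ⟨⟨g.left, c⟩, SemidirectProduct.ext rfl hc⟩

theorem inl_mul_eq {n : ℕ} (g : AffineSp n) (x : Vec n) :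
    (SemidirectProduct.inl (Multiplicative.ofAdd x) : AffineSp n) * g =
      g * SemidirectProduct.inl (Multiplicative.ofAdd ((g.right⁻¹).1 *ᵥ x)) := by
  refine SemidirectProduct.ext ?_ ?_
  · have h : spAction n g.right (Multiplicative.ofAdd ((g.right⁻¹).1 *ᵥ x)) =
        Multiplicative.ofAdd x :=
      congrArg Multiplicative.ofAdd ((sp_inv_mulVec_eq_iff g.right x _).mp rfl).symm
    simp only [SemidirectProduct.mul_left, SemidirectProduct.left_inl, SemidirectProduct.right_inl,
      map_one, MulAut.one_apply, h]
    exact mul_comm _ _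
  · simp

theorem form_inv_mulVec {n : ℕ} (Γ : Sp n) (x y : Vec n) :
    form n ((Γ⁻¹).1 *ᵥ x) y = form n x (Γ.1 *ᵥ y) := by
  rw [← form_symplectic n Γ, ← (sp_inv_mulVec_eq_iff Γ x _).mp rfl]

theorem sigmaOne_ofAdd (m : ℕ) (x : Vec (m + 1)) :
    sigmaOne m (Multiplicative.ofAdd x) = sgn (form (m + 1) x (vecY m)) :=
  sigmaOne_eq m _

/-- Conjugating `(-1)^[x, vecY]` by `g` gives `(-1)^[x, Γ vecY]` with `Γ` the symplectic part.
Equivalent one-dimensional representations have equal characters, and the form is nondegenerate, so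
both sides say `Γ vecY = vecY`. -/
theorem range_inertiaIncl (m : ℕ) :
    (inertiaIncl m).range = inertiaSubgroup (sigmaOneRep m) := by
  let e : Multiplicative (Vec (m + 1)) ≃* translations (m + 1) :=
    MonoidHom.ofInjective (f := (SemidirectProduct.inl : _ →* AffineSp (m + 1)))
      SemidirectProduct.inl_injective
  have hsig : ∀ x v, sigmaOneRep m (e (Multiplicative.ofAdd x)) v =
      sgn (form (m + 1) x (vecY m)) * v := by
    intro x v
    rw [← sigmaOne_ofAdd]
    exact congrArg (fun y => sigmaOne m y * v) (e.symm_apply_apply _)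
  have hconj : ∀ (g : AffineSp (m + 1)) x, MulAut.conjNormal g⁻¹ (e (Multiplicative.ofAdd x)) =
      e (Multiplicative.ofAdd ((g.right⁻¹).1 *ᵥ x)) := by
    intro g x
    apply Subtype.ext
    rw [MulAut.conjNormal_apply, inv_inv]
    change g⁻¹ * SemidirectProduct.inl (Multiplicative.ofAdd x) * g =
      SemidirectProduct.inl (Multiplicative.ofAdd ((g.right⁻¹).1 *ᵥ x))
    rw [mul_assoc, inl_mul_eq, inv_mul_cancel_left]
  ext g
  rw [mem_range_inertiaIncl_iff]
  refine Iff.trans ?_ (conjRep_equiv_iff (sigmaOneRep m) g).symm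
  constructor
  · intro h
    refine ⟨LinearEquiv.refl ℂ ℂ, fun t v => ?_⟩
    obtain ⟨x, rfl⟩ := e.surjective t
    obtain ⟨x, rfl⟩ := Multiplicative.ofAdd.surjective x
    rw [hconj, hsig, form_inv_mulVec, h]
    exact (hsig x v).symm
  · rintro ⟨L, hL⟩
    refine form_eq_of_forall fun x => ?_
    have h1 := hL (e (Multiplicative.ofAdd x)) 1
    rw [hconj, hsig, hsig, form_inv_mulVec, ← smul_eq_mul, ← smul_eq_mul, map_smul] at h1
    have hne : L 1 ≠ 0 := by simp
    rw [form_comm, form_comm _ (vecY m)]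
    exact sgn_injective (smul_left_injective ℂ hne h1)

/-! ### Weight spaces -/

section Weight

variable {n : ℕ} {V : Type*} [AddCommGroup V] [Module ℂ V] (ρ : Representation ℂ (AffineSp n) V)

/-- The subspace on which `ℤ₂^{2n}` acts through the character `x ↦ (-1)^[x, y]`. -/
def weightSpace (y : Vec n) : Submodule ℂ V where
  carrier := {v | ∀ x, ρ (SemidirectProduct.inl (Multiplicative.ofAdd x)) v = sgn (form n x y) • v}
  zero_mem' x := by simp
  add_mem' hv hw x := by rw [map_add, hv, hw, smul_add]
  smul_mem' c v hv x := by rw [map_smul, hv, smul_comm]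

/-- The projection onto a weight space. -/
noncomputable def weightProj (y : Vec n) : Module.End ℂ V :=
  (Fintype.card (Vec n) : ℂ)⁻¹ •
    ∑ x, sgn (form n x y) • ρ (SemidirectProduct.inl (Multiplicative.ofAdd x))

theorem weightProj_apply (y : Vec n) (v : V) : weightProj ρ y v = (Fintype.card (Vec n) : ℂ)⁻¹ •
    ∑ x, sgn (form n x y) • ρ (SemidirectProduct.inl (Multiplicative.ofAdd x)) v := by
  simp [weightProj, LinearMap.sum_apply]

variable {ρ}

theorem mem_weightSpace {y : Vec n} {v : V} : v ∈ weightSpace ρ y ↔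
    ∀ x, ρ (SemidirectProduct.inl (Multiplicative.ofAdd x)) v = sgn (form n x y) • v :=
  Iff.rfl

/-- Moving a translation past `g` by `inl_mul_eq` applies `Γ⁻¹` to it, and the form turns this into
`Γ` applied to the weight. -/
theorem apply_mem_weightSpace {y : Vec n} {v : V} (hv : v ∈ weightSpace ρ y) (g : AffineSp n) :
    ρ g v ∈ weightSpace ρ (g.right.1 *ᵥ y) := by
  intro x
  rw [← Module.End.mul_apply, ← map_mul, inl_mul_eq, map_mul, Module.End.mul_apply, hv, map_smul,
    form_inv_mulVec]

/-- Shifting `x` by a vector pairing to 1 with `y` changes the sign of every term. -/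
theorem sum_sgn_form {y : Vec n} (hy : y ≠ 0) : ∑ x, sgn (form n x y) = 0 := by
  obtain ⟨w, hw⟩ := exists_form_eq_one hy
  have h : ∑ x, sgn (form n x y) = -∑ x, sgn (form n x y) := by
    conv_lhs => rw [← Equiv.sum_comp (Equiv.addRight w)]
    rw [← Finset.sum_neg_distrib]
    refine Finset.sum_congr rfl fun x _ => ?_
    rw [Equiv.coe_addRight, form_add_left, sgn_add, form_comm n w, hw, sgn_one, mul_neg_one]
  exact CharZero.eq_neg_self_iff.mp h

theorem card_vec_ne_zero : (Fintype.card (Vec n) : ℂ) ≠ 0 :=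
  Nat.cast_ne_zero.mpr Fintype.card_ne_zero

theorem weightProj_mem (y : Vec n) (v : V) : weightProj ρ y v ∈ weightSpace ρ y := by
  intro x
  rw [weightProj_apply, map_smul, map_sum, smul_comm]
  congr 1
  rw [Finset.smul_sum]
  refine Fintype.sum_equiv (Equiv.addRight x) _ _ fun z => ?_
  rw [map_smul, ← Module.End.mul_apply, ← map_mul, ← map_mul, ← ofAdd_add, Equiv.coe_addRight,
    smul_smul, form_add_left, sgn_add, mul_comm, mul_assoc, sgn_mul_self, mul_one, add_comm]

theorem weightProj_of_mem {y : Vec n} {v : V} (hv : v ∈ weightSpace ρ y) :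
    weightProj ρ y v = v := by
  rw [weightProj_apply]
  simp only [hv _, smul_smul, sgn_mul_self, one_smul]
  rw [Finset.sum_const, Finset.card_univ, ← Nat.cast_smul_eq_nsmul ℂ, smul_smul,
    inv_mul_cancel₀ card_vec_ne_zero, one_smul]

theorem weightProj_of_mem_of_ne {y y' : Vec n} (h : y ≠ y') {v : V} (hv : v ∈ weightSpace ρ y) :
    weightProj ρ y' v = 0 := by
  have hne : y' + y ≠ 0 := by
    intro h0
    apply h
    rw [← zero_add y, ← vec_add_self y', add_assoc, h0, add_zero]
  rw [weightProj_apply]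
  simp only [hv _, smul_smul, ← sgn_add, ← form_add_right]
  rw [← Finset.sum_smul, sum_sgn_form hne, zero_smul, smul_zero]

/-- Summing the coefficients over `y` first, orthogonality leaves only the term `x = 0`. The
decomposition needs no bound on the dimension of `V`. -/
theorem sum_weightProj (v : V) : ∑ y, weightProj ρ y v = v := by
  simp only [weightProj_apply]
  rw [← Finset.smul_sum, Finset.sum_comm]
  simp only [← Finset.sum_smul]
  rw [Finset.sum_eq_single 0]
  · simp only [form_zero_left, sgn_zero, Finset.sum_const, Finset.card_univ, nsmul_eq_mul, mul_one,
      ofAdd_zero, map_one, Module.End.one_apply]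
    rw [smul_smul, inv_mul_cancel₀ card_vec_ne_zero, one_smul]
  · intro x _ hx
    simp only [form_comm n x]
    rw [sum_sgn_form hx, zero_smul]
  · simp

theorem weightProj_mem_of_invariant {S : Submodule ℂ V} (hS : ∀ g, ∀ v ∈ S, ρ g v ∈ S)
    (y : Vec n) {v : V} (hv : v ∈ S) : weightProj ρ y v ∈ S := by
  rw [weightProj_apply]
  exact S.smul_mem _ (S.sum_mem fun x _ => S.smul_mem _ (hS _ v hv))

end Weight

/-! ### Irreducibility through invariant subspaces -/

theorem isIrreducible_iff {G : Type*} [Group G] {V : Type*} [AddCommGroup V] [Module ℂ V]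
    (ρ : Representation ℂ G V) : ρ.IsIrreducible ↔ Nontrivial V ∧
      ∀ S : Submodule ℂ V, (∀ g, ∀ v ∈ S, ρ g v ∈ S) → S = ⊥ ∨ S = ⊤ := by
  constructor
  · intro h
    refine ⟨?_, fun S hS => ?_⟩
    · by_contra hV
      rw [not_nontrivial_iff_subsingleton] at hV
      exact bot_ne_top (α := Subrepresentation ρ) (Subrepresentation.toSubmodule_injective
        (Subsingleton.elim _ _))
    · exact (eq_bot_or_eq_top (⟨S, fun g v => hS g v⟩ : Subrepresentation ρ)).imp
        (congrArg Subrepresentation.toSubmodule) (congrArg Subrepresentation.toSubmodule)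
  · rintro ⟨hV, h⟩
    exact
      { exists_pair_ne := ⟨⊥, ⊤, fun hbt => bot_ne_top (α := Submodule ℂ V)
          (congrArg Subrepresentation.toSubmodule hbt)⟩
        eq_bot_or_eq_top := fun S => (h S.toSubmodule fun g v hv =>
          S.apply_mem_toSubmodule g hv).imp (fun hS => Subrepresentation.toSubmodule_injective hS)
            fun hS => Subrepresentation.toSubmodule_injective hS }

theorem isIrreducible_of_equiv {G : Type*} [Group G] {V V' : Type*} [AddCommGroup V] [Module ℂ V]
    [AddCommGroup V'] [Module ℂ V'] {ρ : Representation ℂ G V} {ρ' : Representation ℂ G V'}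
    (e : ρ.Equiv ρ') (h : ρ'.IsIrreducible) : ρ.IsIrreducible := by
  rw [isIrreducible_iff] at h ⊢
  obtain ⟨h1, h2⟩ := h
  refine ⟨e.toLinearEquiv.toEquiv.nontrivial, fun S hS => ?_⟩
  have hmap := h2 (S.map (e.toLinearEquiv : V →ₗ[ℂ] V')) (by
    rintro g _ ⟨v, hv, rfl⟩
    exact ⟨ρ g v, hS g v hv, LinearMap.congr_fun (e.isIntertwining' g) v⟩)
  refine hmap.imp (fun h => ?_) fun h => ?_
  · exact (Submodule.map_eq_bot_iff (e := e.toLinearEquiv)).mp h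
  · exact (Submodule.map_eq_top_iff (e := e.toLinearEquiv)).mp h

/-! ### Inflated representations -/

theorem isIrreducible_inflatedRep_iff {n : ℕ} {W : Type u} [AddCommGroup W] [Module ℂ W]
    (ψ : Representation ℂ (Sp n) W) : (inflatedRep n ψ).IsIrreducible ↔ ψ.IsIrreducible := by
  rw [isIrreducible_iff, isIrreducible_iff]
  refine and_congr_right fun _ => forall_congr' fun S => imp_congr_left ?_
  exact ⟨fun h Γ v hv => h (SemidirectProduct.inr Γ) v hv, fun h g v hv => h g.right v hv⟩

theorem equiv_of_inflatedRep_equiv {n : ℕ} {W W' : Type u} [AddCommGroup W] [Module ℂ W]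
    [AddCommGroup W'] [Module ℂ W'] {ψ : Representation ℂ (Sp n) W}
    {ψ' : Representation ℂ (Sp n) W'}
    (e : (inflatedRep n ψ).Equiv (inflatedRep n ψ')) : Nonempty (ψ.Equiv ψ') :=
  ⟨Representation.Equiv.mk e.toLinearEquiv fun Γ =>
    e.toIntertwiningMap.isIntertwining' (SemidirectProduct.inr Γ)⟩

/-- A representation in which `ℤ₂^{2n}` acts trivially is inflated. -/
theorem exists_equiv_inflatedRep {n : ℕ} {V : Type u} [AddCommGroup V] [Module ℂ V]
    (ρ : Representation ℂ (AffineSp n) V) (h : weightSpace ρ 0 = ⊤) :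
    ∃ ψ : Representation ℂ (Sp n) V, Nonempty (ρ.Equiv (inflatedRep n ψ)) := by
  refine ⟨ρ.comp SemidirectProduct.inr,
    ⟨Representation.Equiv.mk (LinearEquiv.refl ℂ V) fun g => ?_⟩⟩
  ext v
  have hv : ρ (SemidirectProduct.inr g.right) v ∈ weightSpace ρ 0 := h ▸ Submodule.mem_top
  have h1 := hv g.left.toAdd
  rw [form_comm, form_zero_left, sgn_zero, one_smul, ofAdd_toAdd, ← Module.End.mul_apply,
    ← map_mul, SemidirectProduct.inl_left_mul_inr_right] at h1
  exact h1

/-! ### Induced representations -/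

section Ind

open Representation TensorProduct

variable {G H : Type*} [Group G] [Group H] (φ : G →* H) {A : Type*} [AddCommGroup A] [Module ℂ A]
  (τ : Representation ℂ G A)

theorem indV_mk_mul (k : G) (h : H) (a : A) :
    IndV.mk φ τ (φ k * h) (τ k a) = IndV.mk φ τ h a := by
  have := Coinvariants.mk_self_apply (Representation.tprod ((leftRegular ℂ H).comp φ) τ) k
    ((MonoidAlgebra.single h 1) ⊗ₜ a)
  simpa using this

theorem ind_apply_mk_one (k : G) (a : A) :
    ind φ τ (φ k) (IndV.mk φ τ 1 a) = IndV.mk φ τ 1 (τ k a) := by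
  rw [ind_mk, ← indV_mk_mul φ τ k]
  simp

/-- A linear map out of an induced representation, given by a compatible family of linear maps. -/
theorem exists_indV_lift {B : Type*} [AddCommGroup B] [Module ℂ B] (F : H → A →ₗ[ℂ] B)
    (hF : ∀ k h a, F (φ k * h) (τ k a) = F h a) :
    ∃ L : IndV φ τ →ₗ[ℂ] B, ∀ h a, L (IndV.mk φ τ h a) = F h a := by
  refine ⟨Coinvariants.lift _ (TensorProduct.lift <| (Finsupp.lift _ _ _ F) ∘ₗ
      (MonoidAlgebra.coeffLinearEquiv ℂ).toLinearMap) fun k => ?_, fun h a => ?_⟩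
  · ext h x
    simp [hF]
  · simp

theorem indV_submodule_eq_top (S : Submodule ℂ (IndV φ τ))
    (hS : ∀ h a, IndV.mk φ τ h a ∈ S) : S = ⊤ := by
  rw [← Submodule.ker_mkQ S, LinearMap.ker_eq_top]
  refine IndV.hom_ext φ τ fun h => LinearMap.ext fun a => ?_
  exact (Submodule.Quotient.mk_eq_zero S).mpr (hS h a)

end Ind

/-- `I` is induced along `φ` from `σ ⊗ ψ`, the space of `ψ` being embedded by `j`. -/
structure IsInduced {G H : Type*} [Group G] [Group H] (φ : G →* H) (σ : G →* ℂ)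
    {W : Type u} {E : Type*} [AddCommGroup W] [Module ℂ W] [AddCommGroup E] [Module ℂ E] (ψ : Representation ℂ G W)
    (I : Representation ℂ H E) (j : W →ₗ[ℂ] E) : Prop where
  apply_map : ∀ k w, I (φ k) (j w) = σ k • j (ψ k w)
  eq_top : ∀ S : Submodule ℂ E, (∀ g w, I g (j w) ∈ S) → S = ⊤
  exists_retraction : ∃ r : E →ₗ[ℂ] W, ∀ w, r (j w) = w
  exists_lift : ∀ (V : Type u) [AddCommGroup V] [Module ℂ V] (ρ : Representation ℂ H V)
    (f : W →ₗ[ℂ] V), (∀ k w, ρ (φ k) (f w) = σ k • f (ψ k w)) →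
      ∃ F : Representation.IntertwiningMap I ρ, ∀ w, F (j w) = f w

section IndChar

open Representation TensorProduct

variable {G H : Type*} [Group G] [Group H] (φ : G →* H) (σ : G →* ℂ) {W : Type u}
  [AddCommGroup W] [Module ℂ W] (ψ : Representation ℂ G W)

/-- The representation space of `ψ` inside the representation induced from `σ ⊗ ψ`. -/
noncomputable def indIncl : W →ₗ[ℂ] IndV φ ((charRep σ).tprod ψ) :=
  IndV.mk φ _ 1 ∘ₗ (TensorProduct.lid ℂ W).symm.toLinearMap

theorem tprod_charRep_apply (k : G) (w : W) :
    (charRep σ).tprod ψ k ((1 : ℂ) ⊗ₜ[ℂ] w) = σ k • ((1 : ℂ) ⊗ₜ[ℂ] ψ k w) := by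
  rw [Representation.tprod_apply, TensorProduct.map_tmul, TensorProduct.smul_tmul']
  rfl

theorem tmul_eq_one_tmul (z : ℂ) (w : W) : z ⊗ₜ[ℂ] w = (1 : ℂ) ⊗ₜ[ℂ] (z • w) := by
  rw [← TensorProduct.smul_tmul, smul_eq_mul, mul_one]

theorem ind_apply_map (k : G) (w : W) :
    ind φ ((charRep σ).tprod ψ) (φ k) (indIncl φ σ ψ w) = σ k • indIncl φ σ ψ (ψ k w) := by
  refine (ind_apply_mk_one φ _ k ((1 : ℂ) ⊗ₜ[ℂ] w)).trans ?_
  rw [tprod_charRep_apply, map_smul]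
  rfl

theorem ind_apply_indIncl (g : H) (w : W) :
    ind φ ((charRep σ).tprod ψ) g (indIncl φ σ ψ w) = IndV.mk φ _ g⁻¹ ((1 : ℂ) ⊗ₜ[ℂ] w) := by
  refine (ind_mk φ _ g 1 ((1 : ℂ) ⊗ₜ[ℂ] w)).trans ?_
  rw [one_mul]

theorem ind_submodule_eq_top (S : Submodule ℂ (IndV φ ((charRep σ).tprod ψ)))
    (hS : ∀ g w, ind φ ((charRep σ).tprod ψ) g (indIncl φ σ ψ w) ∈ S) : S = ⊤ := by
  refine indV_submodule_eq_top _ _ S fun h a => ?_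
  induction a using TensorProduct.induction_on with
  | zero => rw [map_zero]; exact S.zero_mem
  | tmul z w =>
    have h1 := hS h⁻¹ (z • w)
    rwa [ind_apply_indIncl, inv_inv, ← tmul_eq_one_tmul] at h1
  | add a b ha hb => rw [map_add]; exact S.add_mem ha hb

/-- Project onto the component of the trivial coset: the map vanishes off `φ.range` and undoes `τ k`
at `φ k`. Injectivity of `φ` makes `k` unique. The retraction shows that `ψ` embeds in the induced
space. -/
theorem exists_indIncl_retraction (hφ : Function.Injective φ) :
    ∃ r : IndV φ ((charRep σ).tprod ψ) →ₗ[ℂ] W, ∀ w, r (indIncl φ σ ψ w) = w := by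
  classical
  set τ := (charRep σ).tprod ψ
  let F : H → (ℂ ⊗[ℂ] W) →ₗ[ℂ] ℂ ⊗[ℂ] W := fun g =>
    if hg : ∃ k, φ k = g then τ (Classical.choose hg)⁻¹ else 0
  have hF1 : ∀ k, F (φ k) = τ k⁻¹ := by
    intro k
    have hk : ∃ l, φ l = φ k := ⟨k, rfl⟩
    have h : Classical.choose hk = k := hφ (Classical.choose_spec hk)
    simp only [F]
    rw [dif_pos hk, h]
  have hF0 : ∀ g, g ∉ φ.range → F g = 0 := fun g hg => dif_neg hg
  obtain ⟨L, hL⟩ := exists_indV_lift φ τ F (by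
    intro k g a
    by_cases hg : g ∈ φ.range
    · obtain ⟨l, rfl⟩ := hg
      rw [← map_mul, hF1, hF1, ← Module.End.mul_apply, ← map_mul, _root_.mul_inv_rev,
        inv_mul_cancel_right]
    · rw [hF0 g hg, hF0]
      · rfl
      · intro h
        exact hg ((Subgroup.mul_mem_cancel_left _ (MonoidHom.mem_range.mpr ⟨k, rfl⟩)).mp h))
  refine ⟨(TensorProduct.lid ℂ W).toLinearMap ∘ₗ L, fun w => ?_⟩
  have h1 : L (indIncl φ σ ψ w) = (1 : ℂ) ⊗ₜ[ℂ] w := by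
    refine (hL 1 _).trans ?_
    rw [← map_one φ, hF1, inv_one, map_one]
    rfl
  rw [LinearMap.comp_apply, h1]
  simp

/-- The existence half of Frobenius reciprocity. -/
theorem exists_ind_lift {V : Type u} [AddCommGroup V] [Module ℂ V] (ρ : Representation ℂ H V)
    (f : W →ₗ[ℂ] V) (hf : ∀ k w, ρ (φ k) (f w) = σ k • f (ψ k w)) :
    ∃ F : IntertwiningMap (ind φ ((charRep σ).tprod ψ)) ρ, ∀ w, F (indIncl φ σ ψ w) = f w := by
  obtain ⟨L, hL⟩ := exists_indV_lift φ ((charRep σ).tprod ψ)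
    -- The inverse appears because `IndV.mk` at `h` is the translate of the embedded copy by `h⁻¹`,
    -- as in `ind_apply_indIncl`.
    (fun h => ρ h⁻¹ ∘ₗ f ∘ₗ (TensorProduct.lid ℂ W).toLinearMap) (by
      intro k h a
      induction a using TensorProduct.induction_on with
      | zero => simp
      | tmul z w =>
        rw [tmul_eq_one_tmul, tprod_charRep_apply, map_smul, LinearMap.comp_apply,
          LinearMap.comp_apply, LinearMap.comp_apply, LinearMap.comp_apply]
        simp only [LinearEquiv.coe_coe, TensorProduct.lid_tmul, one_smul]
        rw [← map_smul (ρ _), ← hf, ← Module.End.mul_apply, ← map_mul, _root_.mul_inv_rev,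
          inv_mul_cancel_right]
      | add a b ha hb => rw [map_add, map_add, map_add, ha, hb])
  have hL1 : ∀ g w, L (ind φ ((charRep σ).tprod ψ) g (indIncl φ σ ψ w)) = ρ g (f w) := by
    intro g w
    rw [ind_apply_indIncl, hL]
    simp
  refine ⟨⟨L, fun g => ?_⟩, fun w => ?_⟩
  -- Equivariance is checked only on translates of the embedded copy, which generate the induced
  -- space.
  · have hker : LinearMap.ker (L ∘ₗ ind φ ((charRep σ).tprod ψ) g - ρ g ∘ₗ L) = ⊤ := by
      refine ind_submodule_eq_top φ σ ψ _ fun g' w => ?_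
      rw [LinearMap.mem_ker, LinearMap.sub_apply, LinearMap.comp_apply, LinearMap.comp_apply, hL1,
        ← Module.End.mul_apply, ← map_mul, hL1, map_mul, Module.End.mul_apply, sub_self]
    exact sub_eq_zero.mp (LinearMap.ker_eq_top.mp hker)
  · have h := hL1 1 w
    rw [map_one, map_one, Module.End.one_apply, Module.End.one_apply] at h
    exact h

theorem isInduced_ind (hφ : Function.Injective φ) :
    IsInduced φ σ ψ (ind φ ((charRep σ).tprod ψ)) (indIncl φ σ ψ) where
  apply_map := ind_apply_map φ σ ψ
  eq_top := ind_submodule_eq_top φ σ ψ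
  exists_retraction := exists_indIncl_retraction φ σ ψ hφ
  exists_lift _ _ _ ρ f hf := exists_ind_lift φ σ ψ ρ f hf

end IndChar

/-! ### Representations induced from the inertia group -/

theorem isInduced_inducedRep {m : ℕ} {W : Type u} [AddCommGroup W] [Module ℂ W]
    (ψ : Representation ℂ (InertiaQuotient m) W) :
    IsInduced (inertiaIncl m) (sigmaOneExt m) (ψ.comp SemidirectProduct.rightHom) (inducedRep m ψ)
      (indIncl (inertiaIncl m) (sigmaOneExt m) (ψ.comp SemidirectProduct.rightHom)) :=
  isInduced_ind _ _ _ (inertiaIncl_injective m)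

theorem vecY_ne_zero (m : ℕ) : vecY m ≠ 0 := by
  intro h
  have := congrFun h (Sum.inl 0)
  simp [vecY] at this

theorem sp_mulVec_ne_zero {n : ℕ} (Γ : Sp n) {x : Vec n} (hx : x ≠ 0) : Γ.1 *ᵥ x ≠ 0 := by
  intro h
  apply hx
  rw [← (sp_inv_mulVec_eq_iff Γ 0 x).mpr h.symm, Matrix.mulVec_zero]

theorem sigmaOneExt_ne_zero {m : ℕ} (k : InertiaAffine m) : sigmaOneExt m k ≠ 0 := by
  refine right_ne_zero_of_mul_eq_one (a := sigmaOneExt m k⁻¹) ?_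
  rw [← map_mul, inv_mul_cancel, map_one]

/-- A nonzero weight vector of nonzero weight in an invariant subspace can be moved to weight
`vecY`. -/
theorem exists_mem_weightSpace_vecY {m : ℕ} {V : Type*} [AddCommGroup V] [Module ℂ V]
    {ρ : Representation ℂ (AffineSp (m + 1)) V} {S : Submodule ℂ V}
    (hS : ∀ g, ∀ v ∈ S, ρ g v ∈ S) {y : Vec (m + 1)} (hy : y ≠ 0) {v : V} (hv : v ∈ S)
    (hvy : weightProj ρ y v ≠ 0) : ∃ u ∈ S, u ∈ weightSpace ρ (vecY m) ∧ u ≠ 0 := by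
  obtain ⟨Γ, -, hΓ⟩ := exists_transvectionGroup_apply_eq hy (vecY_ne_zero m)
  refine ⟨ρ (SemidirectProduct.inr Γ) (weightProj ρ y v),
    hS _ _ (weightProj_mem_of_invariant hS y hv), ?_, ?_⟩
  · have h := apply_mem_weightSpace (weightProj_mem (ρ := ρ) y v) (SemidirectProduct.inr Γ)
    rwa [SemidirectProduct.right_inr, hΓ] at h
  · intro h
    apply hvy
    have h1 := congrArg (ρ (SemidirectProduct.inr Γ)⁻¹) h
    rwa [← Module.End.mul_apply, ← map_mul, inv_mul_cancel, map_one, Module.End.one_apply,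
      map_zero] at h1

namespace IsInduced

variable {m : ℕ} {W E : Type u} [AddCommGroup W] [Module ℂ W] [AddCommGroup E] [Module ℂ E]
  {ψ : Representation ℂ (InertiaQuotient m) W} {I : Representation ℂ (AffineSp (m + 1)) E}
  {j : W →ₗ[ℂ] E}
  (hI : IsInduced (inertiaIncl m) (sigmaOneExt m) (ψ.comp SemidirectProduct.rightHom) I j)

include hI

theorem apply_inr (c : InertiaQuotient m) (w : W) :
    I (inertiaIncl m (SemidirectProduct.inr c)) (j w) =
      sigmaOneExt m (SemidirectProduct.inr c) • j (ψ c w) :=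
  hI.apply_map (SemidirectProduct.inr c) w

theorem mem_weightSpace (w : W) : j w ∈ weightSpace I (vecY m) := by
  intro x
  have h := hI.apply_map (SemidirectProduct.inl (Multiplicative.ofAdd x)) w
  rw [MonoidHom.comp_apply, SemidirectProduct.rightHom_inl, map_one, Module.End.one_apply] at h
  rw [← sigmaOne_ofAdd]
  refine Eq.trans ?_ h
  congr 2
  exact SemidirectProduct.ext rfl (map_one (inertiaAction m)).symm

/-- The translates of the copy of `ψ` span and have weights `Γ vecY ≠ 0`, so the projection to
weight 0 vanishes identically. -/
theorem weightSpace_zero : weightSpace I 0 = ⊥ := by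
  have h := hI.eq_top (LinearMap.ker (weightProj I 0))
    fun g w => weightProj_of_mem_of_ne (sp_mulVec_ne_zero g.right (vecY_ne_zero m))
      (apply_mem_weightSpace (hI.mem_weightSpace w) g)
  rw [eq_bot_iff]
  intro v hv
  have hk : v ∈ LinearMap.ker (weightProj I 0) := h ▸ Submodule.mem_top
  rw [Submodule.mem_bot, ← weightProj_of_mem hv]
  exact hk

/-- A translate by `g` stays in the copy of `ψ` when `g` fixes `vecY`, since `g` is then in the
inertia group; otherwise it has another weight and is projected to zero. This is how `ψ` is
recovered from the induced representation. -/
theorem weightSpace_vecY : weightSpace I (vecY m) = LinearMap.range j := by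
  apply le_antisymm
  · have h := hI.eq_top
      ((LinearMap.range j).comap (weightProj I (vecY m))) fun g w => by
      have hw := apply_mem_weightSpace (hI.mem_weightSpace w) g
      rw [Submodule.mem_comap]
      by_cases hg : g.right.1 *ᵥ vecY m = vecY m
      · rw [hg] at hw
        rw [weightProj_of_mem hw]
        obtain ⟨k, rfl⟩ := (mem_range_inertiaIncl_iff g).mpr hg
        rw [hI.apply_map]
        exact Submodule.smul_mem _ _ ⟨_, rfl⟩
      · rw [weightProj_of_mem_of_ne hg hw]
        exact Submodule.zero_mem _
    intro v hv
    have hk : v ∈ (LinearMap.range j).comap (weightProj I (vecY m)) := h ▸ Submodule.mem_top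
    rwa [Submodule.mem_comap, weightProj_of_mem hv] at hk
  · rintro _ ⟨w, rfl⟩
    exact hI.mem_weightSpace w

/-- A nonzero invariant subspace contains a vector of some nonzero weight, movable to weight `vecY`,
so it meets the copy of `ψ`. Irreducibility of `ψ` puts the whole copy inside, and the copy
generates. -/
theorem isIrreducible (h : ψ.IsIrreducible) : I.IsIrreducible := by
  rw [isIrreducible_iff] at h ⊢
  obtain ⟨hW, h⟩ := h
  obtain ⟨r, hr⟩ := hI.exists_retraction
  have hinj : Function.Injective j := Function.LeftInverse.injective hr
  refine ⟨hinj.nontrivial, fun S hS => or_iff_not_imp_left.mpr fun hbot => ?_⟩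
  obtain ⟨v, hv, hv0⟩ := Submodule.exists_mem_ne_zero_of_ne_bot hbot
  obtain ⟨y, hy⟩ : ∃ y, weightProj I y v ≠ 0 := by
    by_contra! hc
    apply hv0
    rw [← sum_weightProj (ρ := I) v]
    exact Finset.sum_eq_zero fun y _ => hc y
  have hy0 : y ≠ 0 := by
    rintro rfl
    apply hy
    have := weightProj_mem (ρ := I) 0 v
    rwa [hI.weightSpace_zero, Submodule.mem_bot] at this
  obtain ⟨u, huS, huY, hu0⟩ := exists_mem_weightSpace_vecY hS hy0 hv hy
  rw [hI.weightSpace_vecY] at huY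
  obtain ⟨w, rfl⟩ := huY
  have hcomap := h (S.comap j) (by
    intro c w' hw'
    have h1 := hS (inertiaIncl m (SemidirectProduct.inr c)) _ hw'
    rw [hI.apply_inr] at h1
    exact (Submodule.smul_mem_iff S (sigmaOneExt_ne_zero _)).mp h1)
  rcases hcomap with hc | hc
  · exfalso
    have hw : w ∈ S.comap j := huS
    rw [hc, Submodule.mem_bot] at hw
    exact hu0 (by rw [hw, map_zero])
  · refine hI.eq_top S fun g w' => hS g _ ?_
    have hw' : w' ∈ S.comap j := hc ▸ Submodule.mem_top
    exact hw'

theorem apply_retraction_equiv {E' : Type u} [AddCommGroup E'] [Module ℂ E']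
    {I' : Representation ℂ (AffineSp (m + 1)) E'} (e : I'.Equiv I) {r : E →ₗ[ℂ] W}
    (hr : ∀ w, r (j w) = w) {v : E'} (hv : v ∈ weightSpace I' (vecY m)) :
    j (r (e.toLinearEquiv v)) = e.toLinearEquiv v := by
  have hw : e.toLinearEquiv v ∈ weightSpace I (vecY m) := by
    intro x
    rw [← map_smul, ← hv x]
    exact (LinearMap.congr_fun (e.isIntertwining' _) v).symm
  rw [hI.weightSpace_vecY] at hw
  obtain ⟨w', hw'⟩ := hw
  rw [← hw', hr]

/-- An equivalence preserves weights, so it restricts to the `vecY` weight spaces, the copies of `ψ`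
and `ψ'`; the retractions read off the restricted map. -/
theorem equiv_of_equiv {W' E' : Type u} [AddCommGroup W'] [Module ℂ W'] [AddCommGroup E']
    [Module ℂ E'] {ψ' : Representation ℂ (InertiaQuotient m) W'}
    {I' : Representation ℂ (AffineSp (m + 1)) E'} {j' : W' →ₗ[ℂ] E'}
    (hI' : IsInduced (inertiaIncl m) (sigmaOneExt m) (ψ'.comp SemidirectProduct.rightHom) I' j')
    (e : I.Equiv I') : Nonempty (ψ.Equiv ψ') := by
  obtain ⟨r, hr⟩ := hI.exists_retraction
  obtain ⟨r', hr'⟩ := hI'.exists_retraction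
  have h1 : ∀ w, j' (r' (e.toLinearEquiv (j w))) = e.toLinearEquiv (j w) := fun w =>
    hI'.apply_retraction_equiv e hr' (hI.mem_weightSpace w)
  have h2 : ∀ w, j (r (e.toLinearEquiv.symm (j' w))) = e.toLinearEquiv.symm (j' w) := fun w =>
    hI.apply_retraction_equiv e.symm hr (hI'.mem_weightSpace w)
  let L : W ≃ₗ[ℂ] W' := LinearEquiv.ofLinearMap
    (r' ∘ₗ e.toLinearEquiv.toLinearMap ∘ₗ j)
    (r ∘ₗ e.toLinearEquiv.symm.toLinearMap ∘ₗ j')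
    (LinearMap.ext fun w => by
      change r' (e.toLinearEquiv (j (r (e.toLinearEquiv.symm (j' w))))) = w
      rw [h2, LinearEquiv.apply_symm_apply, hr'])
    (LinearMap.ext fun w => by
      change r (e.toLinearEquiv.symm (j' (r' (e.toLinearEquiv (j w))))) = w
      rw [h1, LinearEquiv.symm_apply_apply, hr])
  refine ⟨Representation.Equiv.mk L fun c => LinearMap.ext fun w => ?_⟩
  change r' (e.toLinearEquiv (j (ψ c w))) = ψ' c (r' (e.toLinearEquiv (j w)))
  have h3 := hI.apply_inr c w
  have h4 := hI'.apply_inr c (r' (e.toLinearEquiv (j w)))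
  have h5 : e.toLinearEquiv (I (inertiaIncl m (SemidirectProduct.inr c)) (j w)) =
      I' (inertiaIncl m (SemidirectProduct.inr c)) (e.toLinearEquiv (j w)) :=
    LinearMap.congr_fun (e.isIntertwining' _) (j w)
  rw [h1, ← h5, h3, map_smul] at h4
  rw [← hr' (ψ' c _)]
  -- Both sides carry the same nonzero factor `σ₁''`, which cancels.
  exact congrArg r' (smul_right_injective _ (sigmaOneExt_ne_zero _) h4)

/-- Weight 0 distinguishes them: it is everything in an inflated representation and nothing in an
induced one. -/
theorem isEmpty_equiv_inflatedRep {W' : Type u} [AddCommGroup W'] [Module ℂ W']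
    (ψ' : Representation ℂ (Sp (m + 1)) W') [Nontrivial W'] :
    IsEmpty (I.Equiv (inflatedRep (m + 1) ψ')) := by
  refine ⟨fun e => ?_⟩
  obtain ⟨w, hw⟩ := exists_ne (0 : W')
  apply hw
  have he : ∀ g v, e.toLinearEquiv (I g v) = inflatedRep (m + 1) ψ' g (e.toLinearEquiv v) :=
    fun g v => LinearMap.congr_fun (e.isIntertwining' g) v
  have h : e.toLinearEquiv.symm w ∈ weightSpace I 0 := by
    intro x
    apply e.toLinearEquiv.injective
    rw [he, form_comm, form_zero_left, sgn_zero, one_smul, LinearEquiv.apply_symm_apply]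
    simp [inflatedRep]
  rw [hI.weightSpace_zero, Submodule.mem_bot] at h
  exact (LinearEquiv.map_eq_zero_iff e.toLinearEquiv.symm).mp h

end IsInduced

/-! ### Irreducible representations with a vector of weight `vecY` -/

section WeightVecY

variable {m : ℕ} {V : Type u} [AddCommGroup V] [Module ℂ V]
  (ρ : Representation ℂ (AffineSp (m + 1)) V)

/-- The representation of the inertia quotient on the weight space of `vecY`. -/
noncomputable def weightRep : Representation ℂ (InertiaQuotient m) (weightSpace ρ (vecY m)) where
  toFun c := (ρ (SemidirectProduct.inr (inertiaAction m c))).restrict fun v hv => by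
    have h := apply_mem_weightSpace hv (SemidirectProduct.inr (inertiaAction m c))
    rwa [SemidirectProduct.right_inr, inertiaAction_vecY] at h
  map_one' := by ext; simp
  map_mul' c d := by ext; simp

theorem coe_weightRep_apply (c : InertiaQuotient m) (v : weightSpace ρ (vecY m)) :
    (weightRep ρ c v : V) = ρ (SemidirectProduct.inr (inertiaAction m c)) v := rfl

/-- On this weight space the inertia group acts by `σ₁'' ⊗ ψ̃`, which is the compatibility required
by `IsInduced.exists_lift`. -/
theorem apply_inertiaIncl (k : InertiaAffine m) (v : weightSpace ρ (vecY m)) :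
    ρ (inertiaIncl m k) v = sigmaOneExt m k • (weightRep ρ k.right v : V) := by
  rw [← SemidirectProduct.inl_left_mul_inr_right (inertiaIncl m k), map_mul, Module.End.mul_apply,
    inertiaIncl_right, ← coe_weightRep_apply, ← ofAdd_toAdd (inertiaIncl m k).left,
    (weightRep ρ k.right v).2, ← sigmaOne_ofAdd]
  rfl

variable {ρ}

/-- The translates of a nonzero invariant `S` span an invariant subspace `T`, which is all of `V`.
Projecting `T` to weight `vecY` lands in `S`, because translates outside the inertia group have
other weights; so `S` is the full weight space. -/
theorem isIrreducible_weightRep (hρ : ρ.IsIrreducible) (h : weightSpace ρ (vecY m) ≠ ⊥) :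
    (weightRep ρ).IsIrreducible := by
  rw [isIrreducible_iff] at hρ ⊢
  refine ⟨Submodule.nontrivial_iff_ne_bot.mpr h, fun S hS => or_iff_not_imp_left.mpr fun hbot => ?_⟩
  set T : Submodule ℂ V := Submodule.span ℂ {v | ∃ g, ∃ s ∈ S, v = ρ g (s : V)} with hT
  have hTinv : ∀ g, ∀ v ∈ T, ρ g v ∈ T := by
    intro g v hv
    have hle : T ≤ T.comap (ρ g) := by
      rw [hT, Submodule.span_le]
      rintro _ ⟨g', s, hs, rfl⟩
      refine Submodule.subset_span ⟨g * g', s, hs, ?_⟩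
      rw [map_mul, Module.End.mul_apply]
    exact hle hv
  have hTle : T ≤ (S.map (weightSpace ρ (vecY m)).subtype).comap (weightProj ρ (vecY m)) := by
    rw [hT, Submodule.span_le]
    rintro _ ⟨g, s, hs, rfl⟩
    have hw := apply_mem_weightSpace s.2 g
    rw [SetLike.mem_coe, Submodule.mem_comap]
    by_cases hg : g.right.1 *ᵥ vecY m = vecY m
    · rw [hg] at hw
      rw [weightProj_of_mem hw]
      obtain ⟨k, rfl⟩ := (mem_range_inertiaIncl_iff g).mpr hg
      rw [apply_inertiaIncl]
      exact Submodule.smul_mem _ _ ⟨_, hS k.right s hs, rfl⟩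
    · rw [weightProj_of_mem_of_ne hg hw]
      exact Submodule.zero_mem _
  have hTtop : T = ⊤ := by
    refine (hρ.2 T hTinv).resolve_left fun hTbot => ?_
    obtain ⟨s, hs, hs0⟩ := Submodule.exists_mem_ne_zero_of_ne_bot hbot
    have hsT : (s : V) ∈ T := Submodule.subset_span ⟨1, s, hs, by simp⟩
    rw [hTbot, Submodule.mem_bot] at hsT
    exact hs0 (Subtype.ext hsT)
  rw [eq_top_iff]
  intro v _
  have hv : (v : V) ∈ T := hTtop ▸ Submodule.mem_top
  obtain ⟨s, hs, hsv⟩ := hTle hv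
  rw [weightProj_of_mem v.2] at hsv
  rwa [← Subtype.ext hsv]

/-- Frobenius reciprocity extends the inclusion of the weight space to an intertwiner between
irreducible representations; it is nonzero, so Schur's lemma makes it bijective. -/
theorem exists_equiv_inducedRep (hρ : ρ.IsIrreducible) (h : weightSpace ρ (vecY m) ≠ ⊥) :
    Nonempty (ρ.Equiv (inducedRep m (weightRep ρ))) := by
  have hI := isInduced_inducedRep (weightRep ρ)
  have hi := hI.isIrreducible (isIrreducible_weightRep hρ h)
  obtain ⟨F, hF⟩ := hI.exists_lift V ρ (weightSpace ρ (vecY m)).subtype (apply_inertiaIncl ρ)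
  rcases Representation.IsIrreducible.bijective_or_eq_zero F with hb | h0
  · exact ⟨(F.ofBijective hb).symm⟩
  · exfalso
    obtain ⟨v, hv, hv0⟩ := Submodule.exists_mem_ne_zero_of_ne_bot h
    apply hv0
    have h1 := hF ⟨v, hv⟩
    rw [h0] at h1
    exact h1.symm

/-- All nonzero weights form one orbit, so if `vecY` does not occur, only weight 0 can. -/
theorem weightSpace_zero_eq_top (h : weightSpace ρ (vecY m) = ⊥) : weightSpace ρ 0 = ⊤ := by
  rw [eq_top_iff]
  intro v _
  rw [← sum_weightProj (ρ := ρ) v]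
  refine Submodule.sum_mem _ fun y _ => ?_
  by_cases hy : y = 0
  · subst hy
    exact weightProj_mem 0 v
  · by_cases hvy : weightProj ρ y v = 0
    · rw [hvy]
      exact Submodule.zero_mem _
    · exfalso
      obtain ⟨u, -, hu, hu0⟩ := exists_mem_weightSpace_vecY (S := ⊤) (by simp) hy
        Submodule.mem_top hvy
      rw [h, Submodule.mem_bot] at hu
      exact hu0 hu

end WeightVecY

end CliffordLift

/-! ### The classification assembled -/

theorem mainTheorem7 (m : ℕ) :
    Function.Injective (CliffordLift.inertiaIncl m) ∧
    (CliffordLift.inertiaIncl m).range =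
      CliffordLift.inertiaSubgroup (CliffordLift.sigmaOneRep m) ∧
    (∀ (V : Type u) [AddCommGroup V] [Module ℂ V]
      (ρ : Representation ℂ (CliffordLift.AffineSp (m + 1)) V),
      ρ.IsIrreducible ↔
        (∃ (W : Type u) (_ : AddCommGroup W) (_ : Module ℂ W)
          (ψ : Representation ℂ (CliffordLift.InertiaQuotient m) W),
          ψ.IsIrreducible ∧ Nonempty (ρ.Equiv (CliffordLift.inducedRep m ψ))) ∨
        (∃ (W : Type u) (_ : AddCommGroup W) (_ : Module ℂ W)
          (ψ : Representation ℂ (CliffordLift.Sp (m + 1)) W),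
          ψ.IsIrreducible ∧ Nonempty (ρ.Equiv (CliffordLift.inflatedRep (m + 1) ψ)))) ∧
    (∀ (W W' : Type u) [AddCommGroup W] [Module ℂ W] [AddCommGroup W'] [Module ℂ W']
      (ψ : Representation ℂ (CliffordLift.InertiaQuotient m) W)
      (ψ' : Representation ℂ (CliffordLift.InertiaQuotient m) W'),
      ψ.IsIrreducible → ψ'.IsIrreducible →
        Nonempty ((CliffordLift.inducedRep m ψ).Equiv (CliffordLift.inducedRep m ψ')) →
        Nonempty (ψ.Equiv ψ')) ∧
    (∀ (W W' : Type u) [AddCommGroup W] [Module ℂ W] [AddCommGroup W'] [Module ℂ W']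
      (ψ : Representation ℂ (CliffordLift.Sp (m + 1)) W)
      (ψ' : Representation ℂ (CliffordLift.Sp (m + 1)) W'),
      ψ.IsIrreducible → ψ'.IsIrreducible →
        Nonempty ((CliffordLift.inflatedRep (m + 1) ψ).Equiv
          (CliffordLift.inflatedRep (m + 1) ψ')) →
        Nonempty (ψ.Equiv ψ')) ∧
    (∀ (W W' : Type u) [AddCommGroup W] [Module ℂ W] [AddCommGroup W'] [Module ℂ W']
      (ψ : Representation ℂ (CliffordLift.InertiaQuotient m) W)
      (ψ' : Representation ℂ (CliffordLift.Sp (m + 1)) W'),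
      ψ.IsIrreducible → ψ'.IsIrreducible →
        IsEmpty ((CliffordLift.inducedRep m ψ).Equiv (CliffordLift.inflatedRep (m + 1) ψ'))) := by
  refine ⟨CliffordLift.inertiaIncl_injective m, CliffordLift.range_inertiaIncl m, ?_, ?_, ?_, ?_⟩
  · intro V _ _ ρ
    constructor
    · intro hρ
      -- The two orbits of characters: no vector of weight `vecY` means inflated from `Sp(2n, 2)`,
      -- otherwise induced from the inertia group.
      by_cases h : CliffordLift.weightSpace ρ (CliffordLift.vecY m) = ⊥
      · obtain ⟨ψ, ⟨e⟩⟩ := CliffordLift.exists_equiv_inflatedRep ρ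
          (CliffordLift.weightSpace_zero_eq_top h)
        exact Or.inr ⟨V, _, _, ψ, (CliffordLift.isIrreducible_inflatedRep_iff ψ).mp
          (CliffordLift.isIrreducible_of_equiv e.symm hρ), ⟨e⟩⟩
      · exact Or.inl ⟨_, _, _, CliffordLift.weightRep ρ,
          CliffordLift.isIrreducible_weightRep hρ h, CliffordLift.exists_equiv_inducedRep hρ h⟩
    · rintro (⟨W, _, _, ψ, hψ, ⟨e⟩⟩ | ⟨W, _, _, ψ, hψ, ⟨e⟩⟩)
      · exact CliffordLift.isIrreducible_of_equiv e
          ((CliffordLift.isInduced_inducedRep ψ).isIrreducible hψ)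
      · exact CliffordLift.isIrreducible_of_equiv e
          ((CliffordLift.isIrreducible_inflatedRep_iff ψ).mpr hψ)
  · rintro W W' _ _ _ _ ψ ψ' - - ⟨e⟩
    exact (CliffordLift.isInduced_inducedRep ψ).equiv_of_equiv
      (CliffordLift.isInduced_inducedRep ψ') e
  · rintro W W' _ _ _ _ ψ ψ' - - ⟨e⟩
    exact CliffordLift.equiv_of_inflatedRep_equiv e
  · intro W W' _ _ _ _ ψ ψ' _ hψ'
    have := ((CliffordLift.isIrreducible_iff ψ').mp hψ').1
    exact (CliffordLift.isInduced_inducedRep ψ).isEmpty_equiv_inflatedRep ψ'
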